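/- For real $a,b$ let $u=u_{a,b}$ denote the radial $C^6$ function on $\mathbb{R}^6$ which solves $\Delta^3 u=-e^{6u}$ in $\mathbb{R}^6$ and, viewed as a function of $r=|x|$, satisfies $u(0)=u'(0)=u'''(0)=u'''''(0)=0$, $u''(0)=a$ and $u''''(0)=b$. For every $a<0$ the solution $u_{a,3}$ exists on all of $\mathbb{R}^6$ and is unique, and $$\int_{\mathbb{R}^6}e^{6u_{a,3}}\,dx<\infty\ \text{ for all sufficiently large } -a,\qquad \lim_{a\to-\infty}\int_{\mathbb{R}^6}e^{6u_{a,3}}\,dx=\infty.$$ In particular, for $a<0$ the conformal metric $g_{u_{a,3}}=e^{2u_{a,3}}|dx|^2$ on $\mathbb{R}^6$ has constant $Q$-curvature $Q_{g_{u_{a,3}}}\equiv 1$, where $Q_{g_u}=e^{-6u}(-\Delta)^3u$ for $g_u=e^{2u}|dx|^2$; its Riemannian volume $\mathrm{vol}(g_{u_{a,3}})$ is finite for all sufficiently large $-a$, and $$\lim_{a\to-\infty}\mathrm{vol}(g_{u_{a,3}})=\infty.$$ -/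

import Mathlib

open Filter Topology MeasureTheory
open scoped Laplacian ENNReal

/-- Six-dimensional Euclidean space. -/
abbrev R6 : Type := EuclideanSpace ℝ (Fin 6)

/-- A function on `ℝ⁶` is radial if its value at `x` depends only on `‖x‖`. -/
def IsRadial (u : R6 → ℝ) : Prop :=
  ∀ x y : R6, ‖x‖ = ‖y‖ → u x = u y

/-- The one-variable profile `r ↦ u(r)` of a radial function, i.e. `u` along the first coordinate
axis. For radial `u` it is even in `r`, and its restriction to `[0, ∞)` determines `u`. -/
noncomputable def radialProfile (u : R6 → ℝ) (r : ℝ) : ℝ :=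
  u (EuclideanSpace.single (0 : Fin 6) r)

/-- `u = u_{a,b}` is an (entire, classical) radial solution of `Δ³ u = - e^{6u}` on `ℝ⁶` with
`u(0) = u'(0) = u'''(0) = u'''''(0) = 0`, `u''(0) = a`, `u''''(0) = b`, where primes are
derivatives of the radial profile. -/
structure IsRadialSolution (a b : ℝ) (u : R6 → ℝ) : Prop where
  contDiff : ContDiff ℝ 6 u
  radial : IsRadial u
  equation : ∀ x : R6, Δ (Δ (Δ u)) x = -Real.exp (6 * u x)
  value_zero : u 0 = 0
  deriv_one : iteratedDeriv 1 (radialProfile u) 0 = 0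
  deriv_two : iteratedDeriv 2 (radialProfile u) 0 = a
  deriv_three : iteratedDeriv 3 (radialProfile u) 0 = 0
  deriv_four : iteratedDeriv 4 (radialProfile u) 0 = b
  deriv_five : iteratedDeriv 5 (radialProfile u) 0 = 0

/-- The conformal metric `g_u = e^{2u} |dx|²` on `ℝ⁶`, given by its matrix in the standard
coordinates. -/
noncomputable def conformalMetric (u : R6 → ℝ) (x : R6) : Matrix (Fin 6) (Fin 6) ℝ :=
  Real.exp (2 * u x) • (1 : Matrix (Fin 6) (Fin 6) ℝ)

/-- The Riemannian volume of `ℝ⁶` for the metric with matrix `g` in the standard coordinates. -/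
noncomputable def riemannianVolume (g : R6 → Matrix (Fin 6) (Fin 6) ℝ) : ℝ≥0∞ :=
  ∫⁻ x : R6, ENNReal.ofReal (Real.sqrt (g x).det)

/-- The `Q`-curvature `Q_{g_u} = e^{-6u} (-Δ)³ u` of the conformal metric `g_u = e^{2u} |dx|²` on
`ℝ⁶`: this is `P_g u + Q_g = Q_{g_u} e^{6u}` for the Euclidean metric `g = |dx|²`, whose critical
GJMS operator is `P_g = (-Δ)³` and whose `Q`-curvature is `Q_g = 0`. -/
noncomputable def qCurvature (u : R6 → ℝ) (x : R6) : ℝ :=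
  Real.exp (-(6 * u x)) * ((fun f : R6 → ℝ => -Δ f)^[3] u) x

/-! Write T for `radialPotential`, the inverse of the radial Laplacian. Since Δu(0) = 6a and Δ²u(0)
= 48, the problem is the fixed point equation φ = T(6a + T(48 - T(e^{6φ}))), and positivity of
e^{6φ} gives φ ≤ ar²/2 + r⁴/8. For a < 0 the nonlinearity may thus be truncated at φ = r⁴/8, which
makes it Lipschitz on bounded intervals; a weighted contraction then yields global existence and
uniqueness (`exists_isProfile`, `IsProfile.unique`).

For a ≤ -1, w = Δ²u = 48 - T(e^{6φ}) must become negative (`exists_bilaplacian_neg`). Otherwise Δu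
would be at least 1 from r = √(-2a) on, u would grow quadratically, and T(e^{6φ}) would exceed 48.
As w decreases, it then stays below a negative constant; two integrations make Δu, then u, tend to
-∞ at least quadratically, so the volume is finite (`integrable_exp`).

The same fact forces the volume to blow up: 48 < T(e^{6φ})(r) ≤ ¼∫₀ʳ t e^{6φ} dt. The range t² ≤ -2a
contributes at most 1/3 to this integral, and beyond it t ≤ t⁵/(4a²). Hence ∫ t⁵e^{6φ} dt, a
multiple of the volume, is at least of order a² (`le_integral_exp`). -/

/-- The weighted mean `∫₀¹ τ⁵ h(τ s) dτ`; for a radial density on `ℝ⁶` with profile `h` it is,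
up to a constant, the mean over the ball of radius `s`. -/
noncomputable def ballMean (h : ℝ → ℝ) (s : ℝ) : ℝ :=
  ∫ τ in (0 : ℝ)..1, τ ^ 5 * h (τ * s)

/-- The profile of the radial solution `f` of `Δ f = h` on `ℝ⁶` with `f 0 = 0`. -/
noncomputable def radialPotential (h : ℝ → ℝ) (r : ℝ) : ℝ :=
  (1 / 2) * ∫ s in (0 : ℝ)..r ^ 2, ballMean h (√s)

/-! ### The radial inverse Laplacian -/

section Operator

variable {h h₁ h₂ : ℝ → ℝ}

lemma continuous_ballMean (hh : Continuous h) : Continuous (ballMean h) := by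
  unfold ballMean
  apply intervalIntegral.continuous_parametric_intervalIntegral_of_continuous' (by fun_prop)

lemma continuous_ballMean_sqrt (hh : Continuous h) : Continuous fun s => ballMean h (√s) :=
  (continuous_ballMean hh).comp Real.continuous_sqrt

lemma pow_mul_ballMean (s : ℝ) : s ^ 6 * ballMean h s = ∫ t in (0 : ℝ)..s, t ^ 5 * h t := by
  have := intervalIntegral.smul_integral_comp_mul_right (a := 0) (b := 1)
    (fun t => t ^ 5 * h t) s
  simp only [zero_mul, one_mul, smul_eq_mul] at this
  rw [← this, ballMean, ← intervalIntegral.integral_const_mul,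
    ← intervalIntegral.integral_const_mul]
  congr 1
  ext τ
  ring

lemma hasDerivAt_radialPotential (hh : Continuous h) (r : ℝ) :
    HasDerivAt (radialPotential h) (r * ballMean h |r|) r := by
  have h1 : HasDerivAt (fun ρ => ∫ s in (0 : ℝ)..ρ, ballMean h (√s)) (ballMean h √(r ^ 2)) (r ^ 2) :=
    intervalIntegral.integral_hasDerivAt_right
      ((continuous_ballMean_sqrt hh).intervalIntegrable _ _)
      (continuous_ballMean_sqrt hh).stronglyMeasurable.stronglyMeasurableAtFilter
      (continuous_ballMean_sqrt hh).continuousAt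
  have h2 : HasDerivAt (radialPotential h) _ r :=
    (HasDerivAt.comp (h := fun x : ℝ => x ^ 2) r h1 (hasDerivAt_pow 2 r)).const_mul (1 / 2)
  rw [Real.sqrt_sq_eq_abs] at h2
  convert h2 using 1
  simp
  ring

lemma continuous_radialPotential (hh : Continuous h) : Continuous (radialPotential h) :=
  continuous_iff_continuousAt.2 fun r => (hasDerivAt_radialPotential hh r).continuousAt

lemma radialPotential_zero : radialPotential h 0 = 0 := by simp [radialPotential]

lemma ballMean_mono (hh₁ : Continuous h₁) (hh₂ : Continuous h₂) {s : ℝ} (hs : 0 ≤ s)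
    (hle : ∀ t, 0 ≤ t → t ≤ s → h₁ t ≤ h₂ t) : ballMean h₁ s ≤ ballMean h₂ s := by
  apply intervalIntegral.integral_mono_on zero_le_one
    (Continuous.intervalIntegrable (by fun_prop) _ _)
    (Continuous.intervalIntegrable (by fun_prop) _ _)
  intro τ hτ
  exact mul_le_mul_of_nonneg_left
    (hle _ (mul_nonneg hτ.1 hs) (mul_le_of_le_one_left hs hτ.2)) (pow_nonneg hτ.1 5)

lemma radialPotential_mono (hh₁ : Continuous h₁) (hh₂ : Continuous h₂) {r : ℝ}
    (hle : ∀ t, 0 ≤ t → t ≤ |r| → h₁ t ≤ h₂ t) :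
    radialPotential h₁ r ≤ radialPotential h₂ r := by
  apply mul_le_mul_of_nonneg_left _ (by norm_num)
  apply intervalIntegral.integral_mono_on (sq_nonneg r)
    ((continuous_ballMean_sqrt hh₁).intervalIntegrable _ _)
    ((continuous_ballMean_sqrt hh₂).intervalIntegrable _ _)
  intro s hs
  apply ballMean_mono hh₁ hh₂ (Real.sqrt_nonneg s)
  intro t ht hts
  refine hle t ht (hts.trans ?_)
  rw [← Real.sqrt_sq_eq_abs]
  exact Real.sqrt_le_sqrt hs.2

lemma ballMean_sub (hh₁ : Continuous h₁) (hh₂ : Continuous h₂) (s : ℝ) :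
    ballMean (fun t => h₁ t - h₂ t) s = ballMean h₁ s - ballMean h₂ s := by
  unfold ballMean
  rw [← intervalIntegral.integral_sub (Continuous.intervalIntegrable (by fun_prop) _ _)
    (Continuous.intervalIntegrable (by fun_prop) _ _)]
  simp only [mul_sub]

lemma radialPotential_sub (hh₁ : Continuous h₁) (hh₂ : Continuous h₂) (r : ℝ) :
    radialPotential (fun t => h₁ t - h₂ t) r = radialPotential h₁ r - radialPotential h₂ r := by
  unfold radialPotential
  simp only [ballMean_sub hh₁ hh₂]
  rw [intervalIntegral.integral_sub
    ((continuous_ballMean_sqrt hh₁).intervalIntegrable _ _)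
    ((continuous_ballMean_sqrt hh₂).intervalIntegrable _ _), mul_sub]

lemma radialPotential_neg (r : ℝ) :
    radialPotential (fun t => -h t) r = -radialPotential h r := by
  simp [radialPotential, ballMean]

lemma radialPotential_const_add_sq (c d r : ℝ) :
    radialPotential (fun t => c + d * t ^ 2) r = c * r ^ 2 / 12 + d * r ^ 4 / 32 := by
  have h1 : ∀ s, 0 ≤ s → ballMean (fun t => c + d * t ^ 2) (√s) = c / 6 + d / 8 * s := by
    intro s hs
    have : ∀ τ : ℝ, τ ^ 5 * (c + d * (τ * √s) ^ 2) = c * τ ^ 5 + d * s * τ ^ 7 := by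
      intro τ
      rw [mul_pow, Real.sq_sqrt hs]
      ring
    simp only [ballMean, this]
    rw [intervalIntegral.integral_add (Continuous.intervalIntegrable (by fun_prop) _ _)
      (Continuous.intervalIntegrable (by fun_prop) _ _)]
    simp only [intervalIntegral.integral_const_mul, integral_pow]
    norm_num
    ring
  rw [radialPotential, intervalIntegral.integral_congr (g := fun s => c / 6 + d / 8 * s)]
  · rw [intervalIntegral.integral_add (Continuous.intervalIntegrable (by fun_prop) _ _)
      (Continuous.intervalIntegrable (by fun_prop) _ _)]
    rw [intervalIntegral.integral_const_mul, integral_id, intervalIntegral.integral_const]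
    simp
    ring
  · intro s hs
    rw [Set.uIcc_of_le (sq_nonneg r)] at hs
    exact h1 s hs.1

lemma radialPotential_const (c r : ℝ) : radialPotential (fun _ => c) r = c * r ^ 2 / 12 := by
  simpa using radialPotential_const_add_sq c 0 r

lemma radialPotential_nonneg (hh : Continuous h) {r : ℝ}
    (hle : ∀ t, 0 ≤ t → t ≤ |r| → 0 ≤ h t) : 0 ≤ radialPotential h r := by
  simpa using (radialPotential_const 0 r).symm.le.trans
    (radialPotential_mono continuous_const hh hle)

/-- In the variable s = r² the potential is a plain integral, and integrating e^{cs} gains 1/c. A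
large c therefore makes the operator small in the weighted norm. -/
lemma abs_radialPotential_le_exp {D c R : ℝ} (hD : 0 ≤ D) (hc : 0 < c)
    (hle : ∀ t, |t| ≤ R → |h t| ≤ D * Real.exp (c * t ^ 2)) {r : ℝ} (hr : |r| ≤ R) :
    |radialPotential h r| ≤ D / (2 * c) * Real.exp (c * r ^ 2) := by
  have h1 : ∀ s, 0 ≤ s → s ≤ r ^ 2 → |ballMean h (√s)| ≤ D * Real.exp (c * s) := by
    intro s hs hsr
    have : ‖∫ τ in (0 : ℝ)..1, τ ^ 5 * h (τ * √s)‖ ≤ D * Real.exp (c * s) * |1 - 0| := by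
      apply intervalIntegral.norm_integral_le_of_norm_le_const
      intro τ hτ
      rw [Set.uIoc_of_le zero_le_one] at hτ
      have hs' : √s ≤ R := by
        refine le_trans ?_ hr
        rw [← Real.sqrt_sq_eq_abs]
        exact Real.sqrt_le_sqrt hsr
      have hts : τ * √s ≤ √s := mul_le_of_le_one_left (Real.sqrt_nonneg s) hτ.2
      have hts0 : 0 ≤ τ * √s := mul_nonneg hτ.1.le (Real.sqrt_nonneg s)
      rw [norm_mul, Real.norm_eq_abs, Real.norm_eq_abs, abs_of_nonneg (pow_nonneg hτ.1.le 5)]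
      calc τ ^ 5 * |h (τ * √s)| ≤ 1 * |h (τ * √s)| :=
            mul_le_mul_of_nonneg_right (pow_le_one₀ hτ.1.le hτ.2) (abs_nonneg _)
        _ = |h (τ * √s)| := one_mul _
        _ ≤ D * Real.exp (c * (τ * √s) ^ 2) := by
            apply hle
            rw [abs_of_nonneg hts0]
            exact hts.trans hs'
        _ ≤ D * Real.exp (c * s) := by
            have : (τ * √s) ^ 2 ≤ s := by
              calc (τ * √s) ^ 2 ≤ (√s) ^ 2 := pow_le_pow_left₀ hts0 hts 2
                _ = s := Real.sq_sqrt hs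
            gcongr
    simpa [ballMean] using this
  have h2 : ‖∫ s in (0 : ℝ)..r ^ 2, ballMean h (√s)‖ ≤
      ∫ s in (0 : ℝ)..r ^ 2, D * Real.exp (c * s) := by
    apply intervalIntegral.norm_integral_le_of_norm_le (sq_nonneg r)
    · exact Eventually.of_forall fun s hs => h1 s hs.1.le hs.2
    · exact Continuous.intervalIntegrable (by fun_prop) _ _
  have h3 : ∫ s in (0 : ℝ)..r ^ 2, D * Real.exp (c * s) =
      D / c * (Real.exp (c * r ^ 2) - 1) := by
    rw [intervalIntegral.integral_const_mul, intervalIntegral.integral_comp_mul_left _ hc.ne']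
    simp
    ring
  rw [h3, Real.norm_eq_abs] at h2
  rw [radialPotential, abs_mul, abs_of_pos (by norm_num : (0 : ℝ) < 1 / 2)]
  calc 1 / 2 * |∫ s in (0 : ℝ)..r ^ 2, ballMean h (√s)|
      ≤ 1 / 2 * (D / c * (Real.exp (c * r ^ 2) - 1)) := by gcongr
    _ ≤ 1 / 2 * (D / c * (Real.exp (c * r ^ 2))) := by
        gcongr
        linarith
    _ = _ := by field_simp

end Operator

/-! ### Fixed points of local contractions -/

/-- `A` halves distances between continuous functions on each interval `[-R, R]`, in a Gaussian
weighted sup norm depending on `R`. -/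
def IsLocalContraction (A : (ℝ → ℝ) → ℝ → ℝ) : Prop :=
  ∀ R : ℝ, 0 < R → ∃ c : ℝ, 0 < c ∧ ∀ φ ψ : ℝ → ℝ, Continuous φ → Continuous ψ → ∀ D : ℝ, 0 ≤ D →
    (∀ t, |t| ≤ R → |φ t - ψ t| ≤ D * Real.exp (c * t ^ 2)) →
      ∀ t, |t| ≤ R → |A φ t - A ψ t| ≤ D / 2 * Real.exp (c * t ^ 2)

lemma exists_abs_sub_le_on_Icc {φ ψ : ℝ → ℝ} (hφ : Continuous φ) (hψ : Continuous ψ) (R : ℝ)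
    {c : ℝ} (hc : 0 < c) :
    ∃ D, 0 ≤ D ∧ ∀ t, |t| ≤ R → |φ t - ψ t| ≤ D * Real.exp (c * t ^ 2) := by
  obtain ⟨D, hD⟩ := (isCompact_Icc (a := -R) (b := R)).exists_bound_of_continuousOn
    (f := fun t => φ t - ψ t) (by fun_prop)
  refine ⟨|D|, abs_nonneg D, fun t ht => ?_⟩
  have h1 := hD t (abs_le.1 ht)
  have h2 : 1 ≤ Real.exp (c * t ^ 2) := Real.one_le_exp (by positivity)
  calc |φ t - ψ t| ≤ |D| := h1.trans (le_abs_self D)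
    _ ≤ |D| * Real.exp (c * t ^ 2) := le_mul_of_one_le_right (abs_nonneg D) h2

lemma IsLocalContraction.eq_of_fixed {A : (ℝ → ℝ) → ℝ → ℝ} (hA : IsLocalContraction A)
    {φ ψ : ℝ → ℝ} (hφ : Continuous φ) (hψ : Continuous ψ) (hAφ : A φ = φ) (hAψ : A ψ = ψ) :
    φ = ψ := by
  ext t
  obtain ⟨c, hc, H⟩ := hA (|t| + 1) (by positivity)
  obtain ⟨D, hD, hD'⟩ := exists_abs_sub_le_on_Icc hφ hψ (|t| + 1) hc
  have key : ∀ n : ℕ, ∀ s, |s| ≤ |t| + 1 →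
      |φ s - ψ s| ≤ (D * (1 / 2) ^ n) * Real.exp (c * s ^ 2) := by
    intro n
    induction n with
    | zero => simpa using hD'
    | succ n ih =>
      intro s hs
      have := H φ ψ hφ hψ _ (by positivity) ih s hs
      rw [hAφ, hAψ] at this
      refine this.trans (le_of_eq ?_)
      ring
  have hlim : Tendsto (fun n : ℕ => (D * (1 / 2) ^ n) * Real.exp (c * t ^ 2)) atTop (𝓝 0) := by
    have := ((tendsto_pow_atTop_nhds_zero_of_lt_one (r := (1 / 2 : ℝ)) (by norm_num)
      (by norm_num)).const_mul D).mul_const (Real.exp (c * t ^ 2))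
    simpa using this
  have := ge_of_tendsto' hlim fun n => key n t (by linarith)
  exact sub_eq_zero.1 (abs_nonpos_iff.1 this)

/-- Picard iteration from 0. The weight depends on R, so no single norm serves; the iterates
converge geometrically on each [-R, R], hence locally uniformly, and the limit is continuous. -/
lemma IsLocalContraction.exists_fixed {A : (ℝ → ℝ) → ℝ → ℝ} (hA : IsLocalContraction A)
    (hcont : ∀ φ, Continuous φ → Continuous (A φ)) : ∃ φ, Continuous φ ∧ A φ = φ := by
  let f : ℕ → ℝ → ℝ := fun n => A^[n] 0
  have hf : ∀ n, Continuous (f n) := by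
    intro n
    induction n with
    | zero => exact continuous_const
    | succ n ih =>
      simp only [f, Function.iterate_succ_apply']
      exact hcont _ ih
  have hfs : ∀ n, f (n + 1) = A (f n) := fun n => Function.iterate_succ_apply' A n 0
  have hgeom : ∀ R : ℝ, 0 < R → ∃ C : ℝ, ∀ n t, |t| ≤ R →
      dist (f n t) (f (n + 1) t) ≤ C * (1 / 2) ^ n := by
    intro R hR
    obtain ⟨c, hc, H⟩ := hA R hR
    obtain ⟨D, hD, hD'⟩ := exists_abs_sub_le_on_Icc (hf 0) (hf 1) R hc
    have key : ∀ n : ℕ, ∀ s, |s| ≤ R →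
        |f n s - f (n + 1) s| ≤ (D * (1 / 2) ^ n) * Real.exp (c * s ^ 2) := by
      intro n
      induction n with
      | zero => simpa using hD'
      | succ n ih =>
        intro s hs
        have := H _ _ (hf n) (hf (n + 1)) _ (by positivity) ih s hs
        rw [← hfs, ← hfs] at this
        refine this.trans (le_of_eq ?_)
        ring
    refine ⟨D * Real.exp (c * R ^ 2), fun n t ht => ?_⟩
    rw [Real.dist_eq]
    have ht2 : t ^ 2 ≤ R ^ 2 := sq_le_sq.2 (by rwa [abs_of_pos hR])
    calc |f n t - f (n + 1) t| ≤ (D * (1 / 2) ^ n) * Real.exp (c * t ^ 2) := key n t ht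
      _ ≤ (D * (1 / 2) ^ n) * Real.exp (c * R ^ 2) := by gcongr
      _ = _ := by ring
  have hlim : ∀ t, ∃ y, Tendsto (fun n => f n t) atTop (𝓝 y) := by
    intro t
    obtain ⟨C, hC⟩ := hgeom (|t| + 1) (by positivity)
    exact cauchySeq_tendsto_of_complete
      (cauchySeq_of_le_geometric (1 / 2) C (by norm_num) fun n => hC n t (by linarith))
  choose φ hφ using hlim
  have hdist : ∀ R : ℝ, 0 < R → ∃ C : ℝ, 0 ≤ C ∧ ∀ n t, |t| ≤ R →
      dist (f n t) (φ t) ≤ C * (1 / 2) ^ n := by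
    intro R hR
    obtain ⟨C, hC⟩ := hgeom R hR
    have hC0 : 0 ≤ C := by
      have := dist_nonneg.trans (hC 0 0 (by simpa using hR.le))
      simpa using this
    refine ⟨2 * C, by positivity, fun n t ht => ?_⟩
    have := dist_le_of_le_geometric_of_tendsto (1 / 2) C (by norm_num)
      (fun n => hC n t ht) (hφ t) n
    refine this.trans (le_of_eq ?_)
    ring
  have hpow : ∀ C : ℝ, Tendsto (fun n : ℕ => C * (1 / 2 : ℝ) ^ n) atTop (𝓝 0) := fun C => by
    simpa using (tendsto_pow_atTop_nhds_zero_of_lt_one (r := (1 / 2 : ℝ)) (by norm_num)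
      (by norm_num)).const_mul C
  have hφc : Continuous φ := by
    have : TendstoLocallyUniformly f φ atTop := by
      rw [Metric.tendstoLocallyUniformly_iff]
      intro ε hε x
      obtain ⟨C, -, hC⟩ := hdist (|x| + 1) (by positivity)
      refine ⟨Metric.ball x 1, Metric.ball_mem_nhds x one_pos, ?_⟩
      filter_upwards [(hpow C).eventually (gt_mem_nhds hε)] with n hn y hy
      rw [dist_comm]
      refine (hC n y ?_).trans_lt hn
      rw [Metric.mem_ball, Real.dist_eq] at hy
      have := abs_sub_abs_le_abs_sub y x
      linarith
    exact this.continuous (Eventually.of_forall hf).frequently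
  refine ⟨φ, hφc, ?_⟩
  ext t
  obtain ⟨c, hc, H⟩ := hA (|t| + 1) (by positivity)
  obtain ⟨C, hC0, hC⟩ := hdist (|t| + 1) (by positivity)
  have h1 : ∀ n, dist (f (n + 1) t) (A φ t) ≤ C * Real.exp (c * t ^ 2) / 2 * (1 / 2) ^ n := by
    intro n
    rw [hfs, Real.dist_eq]
    refine (H _ _ (hf n) hφc (C * (1 / 2) ^ n) (by positivity) ?_ t (by linarith)).trans
      (le_of_eq (by ring))
    intro s hs
    have h2 := hC n s hs
    rw [Real.dist_eq] at h2
    exact h2.trans (le_mul_of_one_le_right (by positivity) (Real.one_le_exp (by positivity)))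
  have h2 : Tendsto (fun n => f (n + 1) t) atTop (𝓝 (A φ t)) :=
    tendsto_iff_dist_tendsto_zero.2
      (squeeze_zero (fun _ => dist_nonneg) h1 (hpow _))
  exact tendsto_nhds_unique h2 ((tendsto_add_atTop_iff_nat 1).2 (hφ t))

/-! ### The integral equation: existence and uniqueness -/

/-- The profile of the radial solution `u` of `Δ³ u = -F` on `ℝ⁶` with `u 0 = 0`, `Δ u 0 = 6 a` and
`Δ² u 0 = 48`. -/
noncomputable def triharmonicPotential (a : ℝ) (F : ℝ → ℝ) : ℝ → ℝ :=
  radialPotential fun t => 6 * a + radialPotential (fun s => 48 - radialPotential F s) t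

section Triharmonic

variable {a : ℝ} {F G φ : ℝ → ℝ}

lemma continuous_triharmonicPotential (hF : Continuous F) :
    Continuous (triharmonicPotential a F) :=
  continuous_radialPotential <| continuous_const.add <| continuous_radialPotential <|
    continuous_const.sub <| continuous_radialPotential hF

/-- Dropping the nonnegative source F only increases the solution, and F = 0 gives exactly this
polynomial. -/
lemma triharmonicPotential_le (hF : Continuous F) (hF0 : ∀ t, 0 ≤ F t) (r : ℝ) :
    triharmonicPotential a F r ≤ a * r ^ 2 / 2 + r ^ 4 / 8 := by
  have hT := continuous_radialPotential hF
  have hw : Continuous fun s => 48 - radialPotential F s := by fun_prop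
  have hv := continuous_radialPotential hw
  have h1 : ∀ t, radialPotential (fun s => 48 - radialPotential F s) t ≤ 4 * t ^ 2 := by
    intro t
    have := radialPotential_mono hw (continuous_const (y := (48 : ℝ))) (r := t) fun s _ _ => by
      linarith [radialPotential_nonneg hF (r := s) fun t _ _ => hF0 t]
    rw [radialPotential_const] at this
    linarith
  calc triharmonicPotential a F r ≤ radialPotential (fun t => 6 * a + 4 * t ^ 2) r :=
        radialPotential_mono (by fun_prop) (by fun_prop) fun t _ _ => by linarith [h1 t]
    _ = _ := by
        rw [radialPotential_const_add_sq]
        ring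

lemma abs_triharmonicPotential_sub_le (hF : Continuous F) (hG : Continuous G) {D c R : ℝ}
    (hD : 0 ≤ D) (hc : 0 < c) (hle : ∀ t, |t| ≤ R → |F t - G t| ≤ D * Real.exp (c * t ^ 2)) {r : ℝ}
    (hr : |r| ≤ R) :
    |triharmonicPotential a F r - triharmonicPotential a G r| ≤
      D / (8 * c ^ 3) * Real.exp (c * r ^ 2) := by
  have hF1 := continuous_radialPotential hF
  have hG1 := continuous_radialPotential hG
  have hF2 := continuous_radialPotential (h := fun s => 48 - radialPotential F s) (by fun_prop)
  have hG2 := continuous_radialPotential (h := fun s => 48 - radialPotential G s) (by fun_prop)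
  have h1 : ∀ t, |t| ≤ R → |(48 - radialPotential F t) - (48 - radialPotential G t)| ≤
      D / (2 * c) * Real.exp (c * t ^ 2) := by
    intro t ht
    rw [sub_sub_sub_cancel_left, abs_sub_comm, ← radialPotential_sub hF hG]
    exact abs_radialPotential_le_exp hD hc hle ht
  have h2 : ∀ t, |t| ≤ R → |(6 * a + radialPotential (fun s => 48 - radialPotential F s) t) -
      (6 * a + radialPotential (fun s => 48 - radialPotential G s) t)| ≤
      D / (2 * c) / (2 * c) * Real.exp (c * t ^ 2) := by
    intro t ht
    rw [add_sub_add_left_eq_sub, ← radialPotential_sub (by fun_prop) (by fun_prop)]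
    exact abs_radialPotential_le_exp (by positivity) hc h1 ht
  rw [triharmonicPotential, triharmonicPotential,
    ← radialPotential_sub (by fun_prop) (by fun_prop)]
  refine (abs_radialPotential_le_exp (by positivity) hc h2 hr).trans (le_of_eq ?_)
  field_simp
  norm_num

lemma abs_exp_sub_exp_le {x y p : ℝ} (hx : x ≤ p) (hy : y ≤ p) :
    |Real.exp x - Real.exp y| ≤ Real.exp p * |x - y| := by
  wlog hxy : x ≤ y generalizing x y
  · rw [abs_sub_comm, abs_sub_comm x]
    exact this hy hx (le_of_not_ge hxy)
  rw [abs_sub_comm, abs_sub_comm x, abs_of_nonneg (sub_nonneg.2 (Real.exp_le_exp.2 hxy)),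
    abs_of_nonneg (sub_nonneg.2 hxy)]
  have h1 : Real.exp x = Real.exp y * Real.exp (x - y) := by
    rw [← Real.exp_add]
    congr 1
    ring
  calc Real.exp y - Real.exp x = Real.exp y * (1 - Real.exp (x - y)) := by rw [h1]; ring
    _ ≤ Real.exp y * (y - x) := by
        refine mul_le_mul_of_nonneg_left ?_ (Real.exp_pos y).le
        linarith [Real.add_one_le_exp (x - y)]
    _ ≤ Real.exp p * (y - x) := by
        gcongr

lemma isLocalContraction_triharmonicPotential (a : ℝ) :
    IsLocalContraction fun φ => triharmonicPotential a fun r => Real.exp (6 * min (φ r) (r ^ 4 / 8)) := by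
  intro R hR
  set L : ℝ := 6 * Real.exp (6 * (R ^ 4 / 8)) with hL
  have hL0 : 0 < L := by positivity
  -- L is the Lipschitz constant of the truncated exponential on [-R, R]. The three potentials
  -- contribute 1/(8c³), and c = 1 + L gives L/(8c³) ≤ 1/2.
  refine ⟨1 + L, by positivity, fun φ ψ hφ hψ D hD hle t ht => ?_⟩
  have h1 : ∀ s, |s| ≤ R → |Real.exp (6 * min (φ s) (s ^ 4 / 8)) -
      Real.exp (6 * min (ψ s) (s ^ 4 / 8))| ≤ (L * D) * Real.exp ((1 + L) * s ^ 2) := by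
    intro s hs
    have hs4 : s ^ 4 ≤ R ^ 4 := by
      have h2 : s ^ 2 ≤ R ^ 2 := sq_le_sq.2 (by rwa [abs_of_pos hR])
      nlinarith [sq_nonneg s, sq_nonneg R]
    have hmin : ∀ y, 6 * min y (s ^ 4 / 8) ≤ 6 * (R ^ 4 / 8) := fun y => by
      linarith [min_le_right y (s ^ 4 / 8)]
    calc _ ≤ Real.exp (6 * (R ^ 4 / 8)) *
          |6 * min (φ s) (s ^ 4 / 8) - 6 * min (ψ s) (s ^ 4 / 8)| :=
          abs_exp_sub_exp_le (hmin _) (hmin _)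
      _ = L * |min (φ s) (s ^ 4 / 8) - min (ψ s) (s ^ 4 / 8)| := by
          rw [← mul_sub, abs_mul, hL]
          norm_num
          ring
      _ ≤ L * |φ s - ψ s| := by
          exact mul_le_mul_of_nonneg_left (abs_inf_sub_inf_le_abs (φ s) (ψ s) (s ^ 4 / 8)) hL0.le
      _ ≤ L * (D * Real.exp ((1 + L) * s ^ 2)) := by
          gcongr
          exact hle s hs
      _ = _ := by ring
  refine (abs_triharmonicPotential_sub_le (by fun_prop) (by fun_prop) (by positivity)
    (by positivity) h1 ht).trans ?_
  gcongr ?_ * _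
  rw [div_le_div_iff₀ (by positivity) (by norm_num)]
  have : 2 * L ≤ 8 * (1 + L) ^ 3 := by nlinarith [pow_pos hL0 3, pow_pos hL0 2]
  nlinarith

/-- For a < 0 the a priori bound lies below r⁴/8, so truncation never acts on a solution. -/
lemma min_eq_of_eq_triharmonicPotential (ha : a < 0) (hF : Continuous F) (hF0 : ∀ t, 0 ≤ F t)
    (r : ℝ) : min (triharmonicPotential a F r) (r ^ 4 / 8) = triharmonicPotential a F r := by
  apply min_eq_left
  have := triharmonicPotential_le (a := a) hF hF0 r
  nlinarith [mul_nonneg (neg_pos.2 ha).le (sq_nonneg r)]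

/-- The integral equation satisfied by the profile of `u_{a,3}`. -/
def IsProfile (a : ℝ) (φ : ℝ → ℝ) : Prop :=
  Continuous φ ∧ triharmonicPotential a (fun r => Real.exp (6 * φ r)) = φ

lemma IsProfile.truncated (ha : a < 0) (hφ : IsProfile a φ) :
    triharmonicPotential a (fun r => Real.exp (6 * min (φ r) (r ^ 4 / 8))) = φ := by
  have hc := hφ.1
  have : ∀ r, min (φ r) (r ^ 4 / 8) = φ r := by
    intro r
    have := min_eq_of_eq_triharmonicPotential ha (F := fun r => Real.exp (6 * φ r))
      (by fun_prop) (fun _ => (Real.exp_pos _).le) r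
    rwa [hφ.2] at this
  simp only [this]
  exact hφ.2

lemma IsProfile.unique (ha : a < 0) {ψ : ℝ → ℝ} (hφ : IsProfile a φ) (hψ : IsProfile a ψ) :
    φ = ψ :=
  (isLocalContraction_triharmonicPotential a).eq_of_fixed hφ.1 hψ.1 (hφ.truncated ha)
    (hψ.truncated ha)

lemma exists_isProfile (ha : a < 0) : ∃ φ, IsProfile a φ := by
  obtain ⟨φ, hφ, hφA⟩ := (isLocalContraction_triharmonicPotential a).exists_fixed
    fun φ hφ => continuous_triharmonicPotential (by fun_prop)
  refine ⟨φ, hφ, ?_⟩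
  have : ∀ r, min (φ r) (r ^ 4 / 8) = φ r := by
    intro r
    have := min_eq_of_eq_triharmonicPotential ha
      (F := fun r => Real.exp (6 * min (φ r) (r ^ 4 / 8)))
      (by fun_prop) (fun _ => (Real.exp_pos _).le) r
    rwa [hφA] at this
  simpa only [this] using hφA

end Triharmonic

/-! ### Regularity of dilation averages -/

/-- Differentiating under the integral gives the same kind of average, with m + 1 for m and the
derivative of H for H. The induction therefore needs arbitrary m and an arbitrary target space. -/
lemma contDiff_integral_pow_smul_dilation {E : Type} [NormedAddCommGroup E] [NormedSpace ℝ E]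
    [ProperSpace E] (n : ℕ) : ∀ (m : ℕ) (F : Type) [NormedAddCommGroup F] [NormedSpace ℝ F]
    (H : E → F), ContDiff ℝ n H →
      ContDiff ℝ n fun x => ∫ τ in (0 : ℝ)..1, τ ^ m • H (τ • x) := by
  induction n with
  | zero =>
    intro m F _ _ H hH
    have hc := contDiff_zero.1 hH
    refine contDiff_zero.2 ?_
    apply intervalIntegral.continuous_parametric_intervalIntegral_of_continuous' (by fun_prop)
  | succ n ih =>
    intro m F _ _ H hH
    have hH1 : ContDiff ℝ 1 H := hH.of_le (by exact_mod_cast Nat.le_add_left 1 n)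
    have hc : Continuous H := hH.continuous
    have hc' : Continuous (fderiv ℝ H) := hH1.continuous_fderiv one_ne_zero
    have hd : Differentiable ℝ H := hH1.differentiable one_ne_zero
    have hH' : ContDiff ℝ n (fderiv ℝ H) := hH.fderiv_right (by exact_mod_cast le_rfl)
    push_cast
    refine contDiff_succ_iff_hasFDerivAt.2 ⟨_, ih (m + 1) _ _ hH', fun x => ?_⟩
    obtain ⟨C, hC⟩ := (isCompact_closedBall (0 : E) (‖x‖ + 1)).exists_bound_of_continuousOn
      hc'.continuousOn
    refine intervalIntegral.hasFDerivAt_integral_of_dominated_of_fderiv_le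
      (F := fun x τ => τ ^ m • H (τ • x)) (F' := fun x τ => τ ^ (m + 1) • fderiv ℝ H (τ • x))
      (bound := fun _ => C) (Metric.ball_mem_nhds x one_pos) ?_ ?_ ?_ ?_ ?_ ?_
    · refine Eventually.of_forall fun y => ?_
      exact Continuous.aestronglyMeasurable (by fun_prop)
    · exact Continuous.intervalIntegrable (by fun_prop) _ _
    · exact Continuous.aestronglyMeasurable (by fun_prop)
    · refine Eventually.of_forall fun τ hτ y hy => ?_
      rw [Set.uIoc_of_le zero_le_one] at hτ
      have hy' : ‖y‖ ≤ ‖x‖ + 1 := by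
        rw [Metric.mem_ball, dist_eq_norm] at hy
        have := norm_sub_norm_le y x
        linarith
      have hmem : τ • y ∈ Metric.closedBall (0 : E) (‖x‖ + 1) := by
        rw [mem_closedBall_zero_iff, norm_smul, Real.norm_of_nonneg hτ.1.le]
        exact (mul_le_of_le_one_left (norm_nonneg y) hτ.2).trans hy'
      rw [norm_smul, Real.norm_of_nonneg (pow_nonneg hτ.1.le _)]
      exact (mul_le_of_le_one_left (norm_nonneg _) (pow_le_one₀ hτ.1.le hτ.2)).trans (hC _ hmem)
    · exact intervalIntegrable_const
    · refine Eventually.of_forall fun τ _ y _ => ?_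
      have h1 : HasFDerivAt (fun y : E => τ • y) (τ • ContinuousLinearMap.id ℝ E) y :=
        (hasFDerivAt_id y).const_smul τ
      have h2 := ((hd (τ • y)).hasFDerivAt.comp y h1).const_smul (τ ^ m)
      refine h2.congr_fderiv ?_
      ext v
      simp [pow_succ, mul_smul]

/-! ### Radial potentials as functions on `ℝ⁶` -/

section Lift

variable {h : ℝ → ℝ}

lemma ballMean_norm (x : R6) :
    ballMean h ‖x‖ = ∫ τ in (0 : ℝ)..1, τ ^ 5 • h ‖τ • x‖ := by
  refine intervalIntegral.integral_congr fun τ hτ => ?_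
  rw [Set.uIcc_of_le zero_le_one] at hτ
  simp [norm_smul, abs_of_nonneg hτ.1]

lemma ContDiff.ballMean_norm {n : ℕ} (hh : ContDiff ℝ n fun x : R6 => h ‖x‖) :
    ContDiff ℝ n fun x : R6 => ballMean h ‖x‖ := by
  simp only [_root_.ballMean_norm]
  exact contDiff_integral_pow_smul_dilation n 5 ℝ _ hh

/-- The potential is a C¹ function of ‖x‖², so the chain rule applies at the origin as well. -/
lemma hasFDerivAt_radialPotential_norm (hh : Continuous h) (x : R6) :
    HasFDerivAt (fun x : R6 => radialPotential h ‖x‖) (ballMean h ‖x‖ • innerSL ℝ x) x := by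
  have h1 : HasDerivAt (fun ρ => ∫ s in (0 : ℝ)..ρ, ballMean h (√s)) (ballMean h √(‖x‖ ^ 2))
      (‖x‖ ^ 2) :=
    intervalIntegral.integral_hasDerivAt_right
      ((continuous_ballMean_sqrt hh).intervalIntegrable _ _)
      (continuous_ballMean_sqrt hh).stronglyMeasurable.stronglyMeasurableAtFilter
      (continuous_ballMean_sqrt hh).continuousAt
  rw [Real.sqrt_sq (norm_nonneg x)] at h1
  have h2 : HasFDerivAt (fun x : R6 => radialPotential h ‖x‖) _ x :=
    (HasDerivAt.comp_hasFDerivAt (f := fun x : R6 => ‖x‖ ^ 2) x h1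
      (hasStrictFDerivAt_norm_sq x).hasFDerivAt).const_mul (1 / 2)
  refine h2.congr_fderiv ?_
  ext v
  simp
  ring

lemma fderiv_radialPotential_norm (hh : Continuous h) :
    fderiv ℝ (fun x : R6 => radialPotential h ‖x‖) = fun x => ballMean h ‖x‖ • innerSL ℝ x :=
  funext fun x => (hasFDerivAt_radialPotential_norm hh x).fderiv

lemma ContDiff.radialPotential_norm {n : ℕ} (hc : Continuous h)
    (hh : ContDiff ℝ n fun x : R6 => h ‖x‖) :
    ContDiff ℝ (n + 1) fun x : R6 => radialPotential h ‖x‖ := by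
  refine contDiff_succ_iff_hasFDerivAt.2 ⟨_, ?_, hasFDerivAt_radialPotential_norm hc⟩
  exact hh.ballMean_norm.smul (innerSL ℝ).contDiff

lemma laplacian_apply_eq_sum (f : R6 → ℝ) (x : R6) :
    Δ f x = ∑ i, fderiv ℝ (fderiv ℝ f) x (EuclideanSpace.basisFun (Fin 6) ℝ i)
      (EuclideanSpace.basisFun (Fin 6) ℝ i) := by
  rw [InnerProductSpace.laplacian_eq_iteratedFDeriv_orthonormalBasis f
    (EuclideanSpace.basisFun (Fin 6) ℝ)]
  simp [iteratedFDeriv_two_apply]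

/-- Both sides are the derivative at t = 1 of t⁶ times the mean at t • x, which equals ∫₀ᵗ s⁵ h(‖s •
x‖) ds. -/
lemma six_mul_add_fderiv_ballMean (hc : Continuous h) (hh : ContDiff ℝ 1 fun x : R6 => h ‖x‖)
    (x : R6) :
    6 * ballMean h ‖x‖ + fderiv ℝ (fun x : R6 => ballMean h ‖x‖) x x = h ‖x‖ := by
  set g : ℝ → ℝ := fun t => h ‖t • x‖ with hg
  have hgc : Continuous g := by fun_prop
  have hgm : ∀ t, ballMean g t = ballMean h ‖t • x‖ := by
    intro t
    rw [ballMean_norm, ballMean]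
    simp [hg, mul_smul]
  have hK : Differentiable ℝ fun x : R6 => ballMean h ‖x‖ :=
    (ContDiff.ballMean_norm (n := 1) (by exact_mod_cast hh)).differentiable (by norm_num)
  have h1 : HasDerivAt (fun t : ℝ => ballMean h ‖t • x‖)
      (fderiv ℝ (fun x : R6 => ballMean h ‖x‖) x x) 1 := by
    have h2 : HasDerivAt (fun t : ℝ => t • x) x 1 := by
      simpa using (hasDerivAt_id (1 : ℝ)).smul_const x
    have h3 := (hK ((1 : ℝ) • x)).hasFDerivAt.comp_hasDerivAt 1 h2
    rwa [one_smul] at h3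
  have h4 : HasDerivAt (fun t : ℝ => t ^ 6 * ballMean h ‖t • x‖)
      (6 * ballMean h ‖x‖ + fderiv ℝ (fun x : R6 => ballMean h ‖x‖) x x) 1 := by
    exact ((hasDerivAt_pow 6 (1 : ℝ)).mul h1).congr_deriv (by norm_num)
  have h5 : HasDerivAt (fun t : ℝ => t ^ 6 * ballMean h ‖t • x‖) (h ‖x‖) 1 := by
    have h6 : (fun t : ℝ => t ^ 6 * ballMean h ‖t • x‖) =
        fun t => ∫ s in (0 : ℝ)..t, s ^ 5 * g s := by
      ext t
      rw [← hgm, pow_mul_ballMean]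
    rw [h6]
    have hgc' : Continuous fun s => s ^ 5 * g s := by fun_prop
    simpa [hg] using intervalIntegral.integral_hasDerivAt_right
      (hgc'.intervalIntegrable 0 1) hgc'.stronglyMeasurable.stronglyMeasurableAtFilter
      hgc'.continuousAt
  exact h4.unique h5

/-- The gradient is B(x)x with B the ball mean; its divergence 6B + x·∇B is h by the preceding
identity. -/
lemma laplacian_radialPotential_norm (hc : Continuous h)
    (hh : ContDiff ℝ 1 fun x : R6 => h ‖x‖) (x : R6) :
    Δ (fun x : R6 => radialPotential h ‖x‖) x = h ‖x‖ := by
  have hK : Differentiable ℝ fun x : R6 => ballMean h ‖x‖ :=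
    (ContDiff.ballMean_norm (n := 1) (by exact_mod_cast hh)).differentiable (by norm_num)
  have h1 : HasFDerivAt (fun x : R6 => ballMean h ‖x‖ • innerSL ℝ x) _ x :=
    (hK x).hasFDerivAt.smul (innerSL ℝ (E := R6)).hasFDerivAt
  rw [laplacian_apply_eq_sum, fderiv_radialPotential_norm hc, h1.fderiv]
  have h2 : fderiv ℝ (fun x : R6 => ballMean h ‖x‖) x x = ∑ i,
      x i * fderiv ℝ (fun x : R6 => ballMean h ‖x‖) x (EuclideanSpace.basisFun (Fin 6) ℝ i) := by
    generalize fderiv ℝ (fun x : R6 => ballMean h ‖x‖) x = L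
    conv_lhs => rw [← (EuclideanSpace.basisFun (Fin 6) ℝ).sum_repr x]
    simp [map_sum]
  rw [← six_mul_add_fderiv_ballMean hc hh x, h2]
  have h3 : ∀ i : Fin 6, innerSL ℝ (EuclideanSpace.single i (1 : ℝ))
      (EuclideanSpace.single i (1 : ℝ)) = 1 := fun i => by
    rw [innerSL_apply_apply]
    simp
  simp [Finset.sum_add_distrib, EuclideanSpace.inner_single_right, mul_comm, h3]

end Lift

lemma ContDiff.laplacian {f : R6 → ℝ} {n : ℕ} (hf : ContDiff ℝ (n + 2 : ℕ) f) :
    ContDiff ℝ n (Δ f) := by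
  have h1 : ContDiff ℝ (n + 1 : ℕ) (fderiv ℝ f) := hf.fderiv_right (by norm_cast)
  have h2 : ContDiff ℝ n (fderiv ℝ (fderiv ℝ f)) := h1.fderiv_right (by norm_cast)
  have h3 : Δ f = fun x => ∑ i, fderiv ℝ (fderiv ℝ f) x (EuclideanSpace.basisFun (Fin 6) ℝ i)
      (EuclideanSpace.basisFun (Fin 6) ℝ i) := funext (laplacian_apply_eq_sum f)
  rw [h3]
  fun_prop

/-! ### Symmetry of radial functions -/

namespace IsRadial

variable {f : R6 → ℝ}

lemma eq_radialProfile (hf : IsRadial f) (x : R6) : f x = radialProfile f ‖x‖ :=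
  hf _ _ (by simp)

lemma radialProfile_neg (hf : IsRadial f) (r : ℝ) : radialProfile f (-r) = radialProfile f r :=
  hf _ _ (by simp)

lemma iteratedDeriv_radialProfile_of_odd (hf : IsRadial f) {n : ℕ} (hn : Odd n) :
    iteratedDeriv n (radialProfile f) 0 = 0 := by
  have h1 := iteratedDeriv_comp_neg n (radialProfile f) 0
  simp only [hf.radialProfile_neg, neg_zero, hn.neg_one_pow] at h1
  have h2 : iteratedDeriv n (radialProfile f) 0 = -iteratedDeriv n (radialProfile f) 0 := by
    simpa using h1
  linarith

lemma laplacian (hf : IsRadial f) (hc : ContDiff ℝ 2 f) : IsRadial (Δ f) := by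
  intro x y hxy
  -- For ‖x‖ = ‖y‖ this reflection carries x to y. It fixes f, and the Laplacian at y may be
  -- computed in the reflected orthonormal basis.
  set L := (ℝ ∙ (x - y))ᗮ.reflection
  have hL : L x = y := Submodule.reflection_sub hxy
  have hfL : f ∘ (L.toContinuousLinearEquiv : R6 →L[ℝ] R6) = f := by
    ext z
    exact hf _ _ (L.norm_map z)
  have h1 : ∀ v w : R6, iteratedFDeriv ℝ 2 f x ![v, w] = iteratedFDeriv ℝ 2 f y ![L v, L w] := by
    intro v w
    have h2 := ContinuousLinearMap.iteratedFDeriv_comp_right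
      (L.toContinuousLinearEquiv : R6 →L[ℝ] R6) hc x (i := 2) le_rfl
    rw [hfL] at h2
    rw [h2, ContinuousMultilinearMap.compContinuousLinearMap_apply]
    have h3 : (L.toContinuousLinearEquiv : R6 →L[ℝ] R6) x = y := hL
    rw [h3]
    congr 1
    ext i
    fin_cases i <;> rfl
  rw [congrFun (InnerProductSpace.laplacian_eq_iteratedFDeriv_orthonormalBasis f
    (EuclideanSpace.basisFun (Fin 6) ℝ)) x,
    congrFun (InnerProductSpace.laplacian_eq_iteratedFDeriv_orthonormalBasis f
    ((EuclideanSpace.basisFun (Fin 6) ℝ).map L)) y]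
  simp only [h1, OrthonormalBasis.map_apply]

/-- Differentiating a radial function twice along a circle around the origin. -/
lemma fderiv_fderiv_apply_of_orthogonal (hf : IsRadial f) (hc : ContDiff ℝ 2 f) {x y : R6}
    (hxy : inner ℝ x y = 0) (hn : ‖x‖ = ‖y‖) : fderiv ℝ (fderiv ℝ f) x y y = fderiv ℝ f x x := by
  have hd : Differentiable ℝ f := hc.differentiable (by norm_num)
  have hd' : Differentiable ℝ (fderiv ℝ f) :=
    (hc.fderiv_right (m := 1) (by norm_num)).differentiable (by norm_num)
  let γ : ℝ → R6 := fun θ => Real.cos θ • x + Real.sin θ • y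
  let γ' : ℝ → R6 := fun θ => (-Real.sin θ) • x + Real.cos θ • y
  have hγ : ∀ θ, HasDerivAt γ (γ' θ) θ := fun θ =>
    ((Real.hasDerivAt_cos θ).smul_const x).add ((Real.hasDerivAt_sin θ).smul_const y)
  have hγ' : HasDerivAt γ' (-x) 0 := by
    have := ((Real.hasDerivAt_sin 0).neg.smul_const x).add ((Real.hasDerivAt_cos 0).smul_const y)
    exact this.congr_deriv (by simp)
  have hnorm : ∀ θ, ‖γ θ‖ = ‖x‖ := by
    intro θ
    rw [← sq_eq_sq₀ (norm_nonneg _) (norm_nonneg _), norm_add_sq_real, inner_smul_left,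
      inner_smul_right, hxy, norm_smul, norm_smul, mul_pow, mul_pow, ← hn]
    simp only [Real.norm_eq_abs, sq_abs]
    linear_combination ‖x‖ ^ 2 * Real.sin_sq_add_cos_sq θ
  have h1 : ∀ θ, fderiv ℝ f (γ θ) (γ' θ) = 0 := by
    intro θ
    have h2 := (hd (γ θ)).hasFDerivAt.comp_hasDerivAt θ (hγ θ)
    have h3 : f ∘ γ = fun _ => f x := funext fun θ => hf _ _ (hnorm θ)
    rw [h3] at h2
    exact h2.unique (hasDerivAt_const θ (f x))
  have hγ0 : γ 0 = x := by simp [γ]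
  have hγ'0 : γ' 0 = y := by simp [γ']
  have h4 : HasDerivAt (fun θ => fderiv ℝ f (γ θ)) (fderiv ℝ (fderiv ℝ f) x y) 0 := by
    have := (hd' (γ 0)).hasFDerivAt.comp_hasDerivAt 0 (hγ 0)
    rwa [hγ0, hγ'0] at this
  -- Differentiating f'(γ)γ' = 0 at θ = 0, with γ'' = -x, gives f''(y, y) - f'(x) = 0.
  have h5 := h4.clm_apply hγ'
  simp only [h1, hγ0, hγ'0, map_neg] at h5
  have := h5.unique (hasDerivAt_const 0 0)
  linarith

end IsRadial

/-! ### The radial Laplacian in one variable -/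

section Profile

variable {f : R6 → ℝ}

lemma euclideanSpace_single_eq_smul (i : Fin 6) (r : ℝ) :
    EuclideanSpace.single i r = r • EuclideanSpace.single i (1 : ℝ) := by
  ext j
  simp

lemma radialProfile_zero (f : R6 → ℝ) : radialProfile f 0 = f 0 := by
  rw [radialProfile, euclideanSpace_single_eq_smul, zero_smul]

lemma hasDerivAt_euclideanSpace_single (r : ℝ) :
    HasDerivAt (fun r : ℝ => EuclideanSpace.single (0 : Fin 6) r)
      (EuclideanSpace.single (0 : Fin 6) (1 : ℝ)) r := by
  have h1 : (fun r : ℝ => EuclideanSpace.single (0 : Fin 6) r) =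
      fun r => r • EuclideanSpace.single (0 : Fin 6) (1 : ℝ) :=
    funext (euclideanSpace_single_eq_smul 0)
  rw [h1]
  simpa using (hasDerivAt_id r).smul_const (EuclideanSpace.single (0 : Fin 6) (1 : ℝ))

lemma ContDiff.radialProfile {n : WithTop ℕ∞} (hf : ContDiff ℝ n f) :
    ContDiff ℝ n (radialProfile f) := by
  have h1 : (_root_.radialProfile f) =
      fun r => f (r • EuclideanSpace.single (0 : Fin 6) (1 : ℝ)) := by
    ext r
    rw [_root_.radialProfile, euclideanSpace_single_eq_smul]
  rw [h1]
  fun_prop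

lemma deriv_radialProfile (hf : ContDiff ℝ 1 f) (r : ℝ) :
    deriv (radialProfile f) r =
      fderiv ℝ f (EuclideanSpace.single 0 r) (EuclideanSpace.single 0 1) :=
  ((hf.differentiable (by norm_num) _).hasFDerivAt.comp_hasDerivAt r (hasDerivAt_euclideanSpace_single r)).deriv

lemma iteratedDeriv_two_radialProfile (hf : ContDiff ℝ 2 f) (r : ℝ) :
    iteratedDeriv 2 (radialProfile f) r =
      fderiv ℝ (fderiv ℝ f) (EuclideanSpace.single 0 r) (EuclideanSpace.single 0 1)
        (EuclideanSpace.single 0 1) := by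
  have hd' : Differentiable ℝ (fderiv ℝ f) :=
    (hf.fderiv_right (m := 1) (by norm_num)).differentiable (by norm_num)
  have h1 : deriv (radialProfile f) = fun r =>
      fderiv ℝ f (EuclideanSpace.single 0 r) (EuclideanSpace.single 0 1) :=
    funext (deriv_radialProfile (hf.of_le (by norm_num)))
  rw [iteratedDeriv_succ, iteratedDeriv_one, h1]
  have h2 := ((hd' _).hasFDerivAt.comp_hasDerivAt r (hasDerivAt_euclideanSpace_single r)).clm_apply
    (hasDerivAt_const r (EuclideanSpace.single (0 : Fin 6) (1 : ℝ)))
  simpa using h2.deriv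

/-- Each of the five transverse second derivatives equals the radial first derivative divided by r,
by the circle argument. Multiplying by r keeps r = 0 in the statement. -/
lemma IsRadial.mul_laplacian (hf : IsRadial f) (hc : ContDiff ℝ 2 f) (r : ℝ) :
    r * radialProfile (Δ f) r =
      r * iteratedDeriv 2 (radialProfile f) r + 5 * deriv (radialProfile f) r := by
  rcases eq_or_ne r 0 with rfl | hr
  · have := hf.iteratedDeriv_radialProfile_of_odd (n := 1) odd_one
    rw [iteratedDeriv_one] at this
    simp [this]
  have h1 : ∀ i : Fin 6, i ≠ 0 → r * fderiv ℝ (fderiv ℝ f) (EuclideanSpace.single 0 r)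
      (EuclideanSpace.single i 1) (EuclideanSpace.single i 1) = deriv (radialProfile f) r := by
    intro i hi
    have h2 := hf.fderiv_fderiv_apply_of_orthogonal hc
      (x := EuclideanSpace.single (0 : Fin 6) r) (y := EuclideanSpace.single i r)
      (by simp [EuclideanSpace.inner_single_left, hi.symm]) (by simp)
    rw [deriv_radialProfile (hc.of_le (by norm_num))]
    generalize fderiv ℝ (fderiv ℝ f) (EuclideanSpace.single 0 r) = M at h2 ⊢
    generalize fderiv ℝ f (EuclideanSpace.single 0 r) = M' at h2 ⊢
    rw [euclideanSpace_single_eq_smul i, euclideanSpace_single_eq_smul 0] at h2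
    simp only [map_smul, smul_apply, smul_eq_mul] at h2
    exact mul_left_cancel₀ hr h2
  rw [radialProfile, laplacian_apply_eq_sum, iteratedDeriv_two_radialProfile hc, Fin.sum_univ_succ,
    mul_add, Finset.mul_sum]
  congr 1
  · simp
  · simp only [EuclideanSpace.basisFun_apply]
    rw [Finset.sum_congr rfl fun i _ => h1 _ (Fin.succ_ne_zero i)]
    simp

lemma iteratedDeriv_id_mul {g : ℝ → ℝ} {n : ℕ} (hg : ContDiff ℝ (n + 1 : ℕ) g) :
    iteratedDeriv (n + 1) (fun r => r * g r) 0 = (n + 1) * iteratedDeriv n g 0 := by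
  have hid : ContDiff ℝ (n + 1 : ℕ) fun r : ℝ => r := contDiff_id
  rw [iteratedDeriv_fun_mul hid.contDiffAt hg.contDiffAt, Finset.sum_eq_single 1]
  · have : iteratedDeriv 1 (fun r : ℝ => r) 0 = 1 := by simp [iteratedDeriv_one]
    simp [this]
  · intro i _ hi
    rcases i with _ | _ | i
    · simp
    · exact absurd rfl hi
    · have : iteratedDeriv (i + 1 + 1) (fun r : ℝ => r) = 0 := by
        rw [iteratedDeriv_succ', iteratedDeriv_succ']
        have h1 : deriv (fun r : ℝ => r) = fun _ => 1 := by
          ext r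
          simp
        have h2 : deriv (fun _ : ℝ => (1 : ℝ)) = 0 := by
          ext r
          simp
        rw [h1, h2]
        ext r
        simp [iteratedDeriv_const_zero]
      simp [this]
  · simp

lemma iteratedDeriv_iteratedDeriv (m n : ℕ) (g : ℝ → ℝ) :
    iteratedDeriv m (iteratedDeriv n g) = iteratedDeriv (m + n) g := by
  simp only [iteratedDeriv_eq_iterate, Function.iterate_add_apply]

lemma ContDiff.iteratedDeriv_of_add {g : ℝ → ℝ} {m n : ℕ} (hg : ContDiff ℝ (m + n : ℕ) g) :
    ContDiff ℝ m (iteratedDeriv n g) := by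
  rw [iteratedDeriv_eq_iterate]
  exact ContDiff.iterate_deriv' m n (by exact_mod_cast hg)

/-- At the origin, the derivatives of the profile of `Δ f` are multiples of those of the profile
of `f`. -/
lemma IsRadial.iteratedDeriv_radialProfile_laplacian (hf : IsRadial f) {n : ℕ}
    (hc : ContDiff ℝ (n + 3 : ℕ) f) :
    (n + 1) * iteratedDeriv n (radialProfile (Δ f)) 0 =
      (n + 6) * iteratedDeriv (n + 2) (radialProfile f) 0 := by
  have hφ := hc.radialProfile
  have hc2 : ContDiff ℝ 2 f := hc.of_le (by exact_mod_cast (by omega : 2 ≤ n + 3))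
  have h1 : (fun r => r * _root_.radialProfile (Δ f) r) = fun r =>
      r * iteratedDeriv 2 (_root_.radialProfile f) r + 5 * deriv (_root_.radialProfile f) r :=
    funext (hf.mul_laplacian hc2)
  have h2 : ContDiff ℝ (n + 1 : ℕ) (_root_.radialProfile (Δ f)) :=
    (ContDiff.laplacian (n := n + 1) hc).radialProfile
  have h3 : ContDiff ℝ (n + 1 : ℕ) (iteratedDeriv 2 (_root_.radialProfile f)) :=
    ContDiff.iteratedDeriv_of_add (m := n + 1) (n := 2) hφ
  have h4 : ContDiff ℝ (n + 1 : ℕ) (deriv (_root_.radialProfile f)) := by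
    rw [← iteratedDeriv_one]
    exact ContDiff.iteratedDeriv_of_add (hφ.of_le (by exact_mod_cast (by omega : n + 1 + 1 ≤ n + 3)))
  have hid : ContDiff ℝ (n + 1 : ℕ) fun r : ℝ => r := contDiff_id
  -- With ψ the profile of Δf and φ that of f, differentiating rψ = rφ'' + 5φ' at 0 n + 1 times
  -- gives coefficients n + 1 on the left and (n + 1) + 5 on the right.
  have h5 := congrArg (fun g => iteratedDeriv (n + 1) g 0) h1
  rw [iteratedDeriv_id_mul h2, iteratedDeriv_fun_add
    (hid.mul h3).contDiffAt (contDiff_const.mul h4).contDiffAt,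
    iteratedDeriv_id_mul h3, iteratedDeriv_const_mul _ h4.contDiffAt,
    iteratedDeriv_iteratedDeriv, ← iteratedDeriv_one, iteratedDeriv_iteratedDeriv] at h5
  rw [h5]
  ring

/-- A radial function is recovered from its Laplacian by integration. -/
lemma IsRadial.radialProfile_eq (hf : IsRadial f) (hc : ContDiff ℝ 2 f) :
    radialProfile f = fun r => f 0 + radialPotential (radialProfile (Δ f)) r := by
  set φ := radialProfile f with hφ
  set ψ := radialProfile (Δ f) with hψ
  have hφc : ContDiff ℝ 2 φ := hc.radialProfile
  have hψc : Continuous ψ :=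
    (ContDiff.laplacian (n := 0) (by exact_mod_cast hc)).radialProfile.continuous
  have hψe : ∀ r, ψ (-r) = ψ r := (hf.laplacian hc).radialProfile_neg
  have hφd : Differentiable ℝ φ := hφc.differentiable (by norm_num)
  have hφ'c : ContDiff ℝ 1 (deriv φ) := by
    rw [← iteratedDeriv_one]
    exact ContDiff.iteratedDeriv_of_add (m := 1) (n := 1) (by exact_mod_cast hφc)
  have hφ'd : Differentiable ℝ (deriv φ) := hφ'c.differentiable (by norm_num)
  -- Divergence form: (r⁵φ')' = r⁵ψ, integrated from 0.
  have h1 : ∀ r, r ^ 5 * deriv φ r = r ^ 6 * ballMean ψ r := by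
    intro r
    rw [pow_mul_ballMean]
    have h2 : ∀ t ∈ Set.uIcc 0 r, HasDerivAt (fun t => t ^ 5 * deriv φ t) (t ^ 5 * ψ t) t := by
      intro t _
      refine ((hasDerivAt_pow 5 t).mul (hφ'd t).hasDerivAt).congr_deriv ?_
      have h3 := hf.mul_laplacian hc t
      rw [iteratedDeriv_succ, iteratedDeriv_one] at h3
      push_cast
      linear_combination -t ^ 4 * h3
    rw [intervalIntegral.integral_eq_sub_of_hasDerivAt h2
      (Continuous.intervalIntegrable (by fun_prop) _ _)]
    simp
  have h2 : ∀ r, deriv φ r = r * ballMean ψ |r| := by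
    intro r
    have h3 : ballMean ψ |r| = ballMean ψ r := by
      rcases abs_choice r with h | h
      · rw [h]
      · rw [h]
        simp [ballMean, hψe]
    rw [h3]
    rcases eq_or_ne r 0 with rfl | hr
    · have := hf.iteratedDeriv_radialProfile_of_odd (n := 1) odd_one
      rw [iteratedDeriv_one] at this
      simpa using this
    · apply mul_left_cancel₀ (pow_ne_zero 5 hr)
      rw [h1]
      ring
  have h3 : ∀ r, HasDerivAt (fun r => φ r - radialPotential ψ r) 0 r := by
    intro r
    refine ((hφd r).hasDerivAt.sub (hasDerivAt_radialPotential hψc r)).congr_deriv ?_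
    rw [h2, sub_self]
  ext r
  have h4 := is_const_of_deriv_eq_zero (fun r => (h3 r).differentiableAt)
    (fun r => (h3 r).deriv) r 0
  have h5 : φ 0 = f 0 := radialProfile_zero f
  simp only [radialPotential_zero, h5] at h4
  linarith

end Profile

/-! ### Equivalence of the PDE and the integral equation -/

section Solution

variable {a : ℝ} {u : R6 → ℝ}

lemma IsRadialSolution.isProfile (hu : IsRadialSolution a 3 u) : IsProfile a (radialProfile u) := by
  have hc0 : ContDiff ℝ (4 + 2 : ℕ) u := by exact_mod_cast hu.contDiff
  have hc1 : ContDiff ℝ (2 + 2 : ℕ) (Δ u) := ContDiff.laplacian hc0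
  have hc2 : ContDiff ℝ (0 + 2 : ℕ) (Δ (Δ u)) := ContDiff.laplacian hc1
  have hr1 : IsRadial (Δ u) := hu.radial.laplacian (hu.contDiff.of_le (by norm_num))
  have hr2 : IsRadial (Δ (Δ u)) := hr1.laplacian (hc1.of_le (by norm_cast))
  have i1 : Δ u 0 = 6 * a := by
    have := hu.radial.iteratedDeriv_radialProfile_laplacian (n := 0)
      (hu.contDiff.of_le (by norm_cast))
    simpa [radialProfile_zero, hu.deriv_two] using this
  -- The second derivative of the profile of Δu at 0 is (8/3)·3 = 8, and Δ²u(0) is six times that.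
  have i2 : Δ (Δ u) 0 = 48 := by
    have h1 := hu.radial.iteratedDeriv_radialProfile_laplacian (n := 2)
      (hu.contDiff.of_le (by norm_cast))
    have h2 := hr1.iteratedDeriv_radialProfile_laplacian (n := 0) (hc1.of_le (by norm_cast))
    norm_num [radialProfile_zero, hu.deriv_four] at h1 h2
    linarith
  have h0 := hu.radial.radialProfile_eq (hu.contDiff.of_le (by norm_num))
  have h1 := hr1.radialProfile_eq (hc1.of_le (by norm_cast))
  have h2 := hr2.radialProfile_eq (hc2.of_le (by norm_cast))
  have h3 : radialProfile (Δ (Δ (Δ u))) = fun r => -Real.exp (6 * radialProfile u r) :=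
    funext fun r => hu.equation _
  simp only [h3, radialPotential_neg, i2, ← sub_eq_add_neg] at h2
  refine ⟨hu.contDiff.radialProfile.continuous, ?_⟩
  rw [i1, h2] at h1
  rw [hu.value_zero, h1] at h0
  rw [triharmonicPotential]
  conv_rhs => rw [h0]
  simp

lemma IsProfile.isRadialSolution {φ : ℝ → ℝ} (hφ : IsProfile a φ) :
    IsRadialSolution a 3 fun x => φ ‖x‖ := by
  obtain ⟨hφc, hφ⟩ := hφ
  set E : ℝ → ℝ := fun r => Real.exp (6 * φ r) with hE
  set w : ℝ → ℝ := fun r => 48 - radialPotential E r with hw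
  set v : ℝ → ℝ := fun r => 6 * a + radialPotential w r with hv
  have hφv : φ = radialPotential v := hφ.symm
  have hEc : Continuous E := by fun_prop
  have hTE := continuous_radialPotential hEc
  have hwc : Continuous w := by fun_prop
  have hTw := continuous_radialPotential hwc
  have hvc : Continuous v := by fun_prop
  have hE_of : ∀ n : ℕ, ContDiff ℝ n (fun x : R6 => φ ‖x‖) → ContDiff ℝ n fun x : R6 => E ‖x‖ :=
    fun n h => (contDiff_const.mul h).exp
  have hw_of : ∀ n : ℕ, ContDiff ℝ n (fun x : R6 => φ ‖x‖) →
      ContDiff ℝ (n + 1 : ℕ) fun x : R6 => w ‖x‖ := fun n h =>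
    contDiff_const.sub ((hE_of n h).radialPotential_norm hEc)
  have hv_of : ∀ n : ℕ, ContDiff ℝ n (fun x : R6 => φ ‖x‖) →
      ContDiff ℝ (n + 1 + 1 : ℕ) fun x : R6 => v ‖x‖ := fun n h =>
    contDiff_const.add ((hw_of n h).radialPotential_norm hwc)
  have hφ_of : ∀ n : ℕ, ContDiff ℝ n (fun x : R6 => φ ‖x‖) →
      ContDiff ℝ (n + 1 + 1 + 1 : ℕ) fun x : R6 => φ ‖x‖ := fun n h => by
    rw [hφv]
    exact (hv_of n h).radialPotential_norm hvc
  have hφ0 : ContDiff ℝ (0 : ℕ) fun x : R6 => φ ‖x‖ :=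
    contDiff_zero.2 (hφc.comp continuous_norm)
  -- Bootstrap: one pass through the three potentials gains three derivatives, so two passes reach
  -- C⁶ from C⁰.
  have hφ6 : ContDiff ℝ (6 : ℕ) fun x : R6 => φ ‖x‖ := hφ_of 3 (hφ_of 0 hφ0)
  have one_le : ∀ n : ℕ, 1 ≤ n → (1 : WithTop ℕ∞) ≤ (n : ℕ) := fun n h => by exact_mod_cast h
  have l1 : Δ (fun x : R6 => φ ‖x‖) = fun x => v ‖x‖ := by
    ext x
    rw [hφv]
    exact laplacian_radialPotential_norm hvc ((hv_of 6 hφ6).of_le (one_le _ (by norm_num))) x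
  have l2 : Δ (fun x : R6 => v ‖x‖) = fun x => w ‖x‖ := by
    ext x
    have hT : ContDiff ℝ (2 : ℕ) fun x : R6 => radialPotential w ‖x‖ :=
      ((hw_of 6 hφ6).of_le (one_le _ (by norm_num))).radialPotential_norm (n := 1) hwc
    have h1 : (fun x : R6 => v ‖x‖) =
        (fun _ => 6 * a) + fun x : R6 => radialPotential w ‖x‖ := rfl
    rw [h1, contDiffAt_const.laplacian_add hT.contDiffAt, InnerProductSpace.laplacian_const,
      Pi.zero_apply, zero_add]
    exact laplacian_radialPotential_norm hwc ((hw_of 6 hφ6).of_le (one_le _ (by norm_num))) x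
  have l3 : Δ (fun x : R6 => w ‖x‖) = fun x => -E ‖x‖ := by
    ext x
    have hT : ContDiff ℝ (2 : ℕ) fun x : R6 => radialPotential E ‖x‖ :=
      ((hE_of 6 hφ6).of_le (one_le _ (by norm_num))).radialPotential_norm (n := 1) hEc
    have h1 : (fun x : R6 => w ‖x‖) =
        (fun _ => 48) - fun x : R6 => radialPotential E ‖x‖ := rfl
    rw [h1, contDiffAt_const.laplacian_sub hT.contDiffAt, InnerProductSpace.laplacian_const,
      Pi.zero_apply, zero_sub, neg_inj]
    exact laplacian_radialPotential_norm hEc ((hE_of 6 hφ6).of_le (one_le _ (by norm_num))) x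
  have hrad : ∀ g : ℝ → ℝ, IsRadial fun x => g ‖x‖ := fun g x y hxy => by simp only [hxy]
  have e0 : ∀ g : ℝ → ℝ, radialProfile (fun x => g ‖x‖) 0 = g 0 := fun g => by
    rw [radialProfile_zero, norm_zero]
  have hv4 : ContDiff ℝ (0 + 3 : ℕ) fun x : R6 => v ‖x‖ :=
    (hv_of 6 hφ6).of_le (by norm_cast)
  have d2 := (hrad φ).iteratedDeriv_radialProfile_laplacian (n := 0) (hφ6.of_le (by norm_cast))
  have d4 := (hrad φ).iteratedDeriv_radialProfile_laplacian (n := 2) (hφ6.of_le (by norm_cast))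
  have d2' := (hrad v).iteratedDeriv_radialProfile_laplacian (n := 0) hv4
  rw [l1] at d2 d4
  rw [l2] at d2'
  have hv0 : v 0 = 6 * a := by simp [hv, radialPotential_zero]
  have hw0 : w 0 = 48 := by simp [hw, radialPotential_zero]
  norm_num [e0, hv0, hw0] at d2 d4 d2'
  exact
    { contDiff := by exact_mod_cast hφ6
      radial := hrad φ
      equation := fun x => by rw [l1, l2, l3]
      value_zero := by simp [hφv, radialPotential_zero]
      deriv_one := (hrad φ).iteratedDeriv_radialProfile_of_odd (by decide)
      deriv_two := by linarith
      deriv_three := (hrad φ).iteratedDeriv_radialProfile_of_odd (by decide)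
      deriv_four := by linarith
      deriv_five := (hrad φ).iteratedDeriv_radialProfile_of_odd (by decide) }

theorem existsUnique_isRadialSolution (ha : a < 0) : ∃! u, IsRadialSolution a 3 u := by
  obtain ⟨φ, hφ⟩ := exists_isProfile ha
  refine ⟨_, hφ.isRadialSolution, fun u hu => ?_⟩
  ext x
  rw [hu.radial.eq_radialProfile x, hu.isProfile.unique ha hφ]

end Solution

/-! ### Growth estimates for the potential -/

section Estimates

variable {h : ℝ → ℝ}

lemma hasDerivAt_ballMean (hh : Continuous h) {r : ℝ} (hr : 0 < r) :
    HasDerivAt (ballMean h) ((h r - 6 * ballMean h r) / r) r := by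
  have hc : Continuous fun t => t ^ 5 * h t := by fun_prop
  have h1 : HasDerivAt (fun s => ∫ t in (0 : ℝ)..s, t ^ 5 * h t) (r ^ 5 * h r) r :=
    intervalIntegral.integral_hasDerivAt_right (hc.intervalIntegrable _ _)
      hc.stronglyMeasurable.stronglyMeasurableAtFilter hc.continuousAt
  have h2 := h1.div (hasDerivAt_pow 6 r) (pow_ne_zero 6 hr.ne')
  have h3 : ballMean h =ᶠ[𝓝 r] (fun s => ∫ t in (0 : ℝ)..s, t ^ 5 * h t) / fun s => s ^ 6 := by
    filter_upwards [lt_mem_nhds hr] with s hs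
    rw [Pi.div_apply, ← pow_mul_ballMean, mul_div_cancel_left₀ _ (pow_ne_zero 6 hs.ne')]
  refine (h2.congr_of_eventuallyEq h3).congr_deriv ?_
  rw [← pow_mul_ballMean]
  field_simp
  ring

/-- In fact T h(r) + ¼ r² · `ballMean h r` = ¼∫₀ʳ t h(t) dt, both sides having equal derivatives;
the term with the mean is nonnegative and is dropped. -/
lemma radialPotential_le_integral (hh : Continuous h) (h0 : ∀ t, 0 ≤ t → 0 ≤ h t) {r : ℝ}
    (hr : 0 ≤ r) : radialPotential h r ≤ 1 / 4 * ∫ t in (0 : ℝ)..r, t * h t := by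
  have hB := continuous_ballMean hh
  have hT := continuous_radialPotential hh
  have hc : Continuous fun t => t * h t := by fun_prop
  have hI : ∀ s, HasDerivAt (fun s => ∫ t in (0 : ℝ)..s, t * h t) (s * h s) s := fun s =>
    intervalIntegral.integral_hasDerivAt_right (hc.intervalIntegrable _ _)
      hc.stronglyMeasurable.stronglyMeasurableAtFilter hc.continuousAt
  have hIc : Continuous fun s => ∫ t in (0 : ℝ)..s, t * h t :=
    continuous_iff_continuousAt.2 fun s => (hI s).continuousAt
  have hd : ∀ s, 0 < s → HasDerivAt (fun s => radialPotential h s +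
      1 / 4 * (s ^ 2 * ballMean h s) - 1 / 4 * ∫ t in (0 : ℝ)..s, t * h t) 0 s := by
    intro s hs
    refine (((hasDerivAt_radialPotential hh s).add
      (((hasDerivAt_pow 2 s).mul (hasDerivAt_ballMean hh hs)).const_mul (1 / 4))).sub
      ((hI s).const_mul (1 / 4))).congr_deriv ?_
    rw [abs_of_pos hs]
    field_simp
    ring
  have h1 := antitoneOn_of_deriv_nonpos (convex_Ici (0 : ℝ)) (f := fun s => radialPotential h s +
      1 / 4 * (s ^ 2 * ballMean h s) - 1 / 4 * ∫ t in (0 : ℝ)..s, t * h t)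
    (by fun_prop)
    (fun s hs => (hd s (by simpa using hs)).differentiableAt.differentiableWithinAt)
    (fun s hs => (hd s (by simpa using hs)).deriv.le)
  have h2 := h1 (Set.mem_Ici.2 le_rfl) (Set.mem_Ici.2 hr) hr
  simp only [radialPotential_zero] at h2
  have h3 : 0 ≤ ballMean h r := by
    have := ballMean_mono (continuous_const (y := (0 : ℝ))) hh hr fun t ht _ => h0 t ht
    simpa [ballMean] using this
  have h4 : 0 ≤ r ^ 2 * ballMean h r := by positivity
  norm_num at h2
  linarith

lemma radialPotential_monotoneOn (hh : Continuous h) {R : ℝ} (hR : 0 ≤ R)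
    (hB : ∀ r, R < r → 0 ≤ ballMean h r) : MonotoneOn (radialPotential h) (Set.Ici R) := by
  refine monotoneOn_of_deriv_nonneg (convex_Ici R) (continuous_radialPotential hh).continuousOn
    (fun r _ => (hasDerivAt_radialPotential hh r).differentiableAt.differentiableWithinAt) ?_
  intro r hr
  rw [interior_Ici, Set.mem_Ioi] at hr
  rw [(hasDerivAt_radialPotential hh r).deriv, abs_of_pos (hR.trans_lt hr)]
  exact mul_nonneg (hR.trans hr.le) (hB r hr)

lemma exists_ballMean_ge (hh : Continuous h) {c R : ℝ} (hc : 0 < c)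
    (hle : ∀ t, R ≤ t → c ≤ h t) : ∃ R', 0 ≤ R' ∧ ∀ s, R' ≤ s → c / 12 ≤ ballMean h s := by
  wlog hR : 0 ≤ R generalizing R
  · exact this (R := 0) (fun t ht => hle t (by linarith)) le_rfl
  have hc5 : Continuous fun t => t ^ 5 * h t := by fun_prop
  -- Here s⁶ · `ballMean h s` ≥ cs⁶/6 - M, and half of the main term absorbs M once s⁶ ≥ 12M/c.
  set M : ℝ := |∫ t in (0 : ℝ)..R, t ^ 5 * h t| + c * R ^ 6 / 6 with hM
  refine ⟨max R (max 1 (12 * M / c)), hR.trans (le_max_left _ _), fun s hs => ?_⟩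
  have hRs : R ≤ s := (le_max_left _ _).trans hs
  have h1s : 1 ≤ s := (le_max_left _ _).trans ((le_max_right _ _).trans hs)
  have hMs : 12 * M / c ≤ s := (le_max_right _ _).trans ((le_max_right _ _).trans hs)
  have h1 : ∫ t in R..s, t ^ 5 * c ≤ ∫ t in R..s, t ^ 5 * h t := by
    apply intervalIntegral.integral_mono_on hRs (Continuous.intervalIntegrable (by fun_prop) _ _)
      (hc5.intervalIntegrable _ _)
    intro t ht
    exact mul_le_mul_of_nonneg_left (hle t ht.1) (pow_nonneg (hR.trans ht.1) 5)
  rw [intervalIntegral.integral_mul_const, integral_pow] at h1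
  norm_num at h1
  have h2 := intervalIntegral.integral_add_adjacent_intervals
    (hc5.intervalIntegrable (μ := volume) 0 R) (hc5.intervalIntegrable R s)
  have h3 := pow_mul_ballMean (h := h) s
  have h4 := neg_abs_le (∫ t in (0 : ℝ)..R, t ^ 5 * h t)
  have h5 : s ≤ s ^ 6 := le_self_pow₀ h1s (by norm_num)
  have h6 : 12 * M ≤ s ^ 6 * c := (div_le_iff₀ hc).1 (hMs.trans h5)
  have h7 : s ^ 6 * (c / 12) ≤ s ^ 6 * ballMean h s := by
    rw [h3, ← h2]
    linarith
  exact le_of_mul_le_mul_left h7 (by positivity)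

/-- If `Δ f` is eventually bounded below by a positive constant, then the radial function `f`
grows quadratically. -/
lemma exists_radialPotential_ge (hh : Continuous h) {c R : ℝ} (hc : 0 < c)
    (hle : ∀ t, R ≤ t → c ≤ h t) :
    ∃ B, ∀ r, 0 ≤ r → c / 24 * r ^ 2 - B ≤ radialPotential h r := by
  obtain ⟨R', hR', hB⟩ := exists_ballMean_ge hh hc hle
  obtain ⟨B₀, hB₀⟩ := (isCompact_Icc (a := (0 : ℝ)) (b := R')).exists_bound_of_continuousOn
    (continuous_radialPotential hh).continuousOn
  have hb : ∀ r, 0 ≤ r → r ≤ R' → -B₀ ≤ radialPotential h r := fun r h1 h2 =>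
    (abs_le.1 (hB₀ r ⟨h1, h2⟩)).1
  refine ⟨B₀ + c / 24 * R' ^ 2, fun r hr => ?_⟩
  rcases le_total r R' with h1 | h1
  · have h2 : c / 24 * r ^ 2 ≤ c / 24 * R' ^ 2 := by gcongr
    linarith [hb r hr h1]
  · have hhc : Continuous fun t => h t - c / 2 := by fun_prop
    -- The constant c/2 has ball mean c/12, the lower bound for that of h, and potential cr²/24. So
    -- T h - cr²/24 is nondecreasing beyond R'.
    have h2 : MonotoneOn (radialPotential fun t => h t - c / 2) (Set.Ici R') := by
      refine radialPotential_monotoneOn hhc hR' fun s hs => ?_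
      have h3 := hB s hs.le
      have h4 : ballMean (fun _ => c / 2) s = c / 12 := by
        simp [ballMean]
        ring
      rw [ballMean_sub hh continuous_const, h4]
      linarith
    have h5 := h2 (Set.mem_Ici.2 le_rfl) (Set.mem_Ici.2 h1) h1
    rw [radialPotential_sub hh continuous_const, radialPotential_sub hh continuous_const,
      radialPotential_const, radialPotential_const] at h5
    linarith [hb R' hR' le_rfl]

end Estimates

/-! ### Finiteness and growth of the volume -/

namespace IsProfile

variable {a : ℝ} {φ : ℝ → ℝ}

lemma le_polynomial (hφ : IsProfile a φ) (r : ℝ) : φ r ≤ a * r ^ 2 / 2 + r ^ 4 / 8 := by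
  have hc := hφ.1
  rw [← congrFun hφ.2 r]
  exact triharmonicPotential_le (by fun_prop) (fun _ => (Real.exp_pos _).le) r

lemma integral_mul_exp_le (ha : a ≤ -1) (r : ℝ) :
    ∫ t in (0 : ℝ)..r, t * Real.exp (3 / 2 * a * t ^ 2) ≤ 1 / 3 := by
  have ha0 : a ≠ 0 := by linarith
  have h1 : ∀ t ∈ Set.uIcc 0 r, HasDerivAt (fun t => Real.exp (3 / 2 * a * t ^ 2) / (3 * a))
      (t * Real.exp (3 / 2 * a * t ^ 2)) t := by
    intro t _
    refine (((hasDerivAt_pow 2 t).const_mul (3 / 2 * a)).exp.div_const (3 * a)).congr_deriv ?_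
    field_simp
    norm_num
  rw [intervalIntegral.integral_eq_sub_of_hasDerivAt h1
    (Continuous.intervalIntegrable (by fun_prop) _ _)]
  have h2 : Real.exp (3 / 2 * a * r ^ 2) / (3 * a) ≤ 0 :=
    div_nonpos_of_nonneg_of_nonpos (Real.exp_pos _).le (by linarith)
  have h3 : -(1 / (3 * a)) ≤ 1 / 3 := by
    rw [← one_div_neg_eq_neg_one_div]
    exact one_div_le_one_div_of_le (by norm_num) (by linarith)
  simp only [ne_eq, OfNat.ofNat_ne_zero, not_false_eq_true, zero_pow, mul_zero, Real.exp_zero]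
  linarith

/-- On this range r⁴/8 absorbs at most half of ar²/2, leaving φ ≤ ar²/4. -/
lemma exp_le_of_sq_le (hφ : IsProfile a φ) {t : ℝ} (ht : t ^ 2 ≤ -2 * a) :
    Real.exp (6 * φ t) ≤ Real.exp (3 / 2 * a * t ^ 2) := by
  apply Real.exp_le_exp.2
  have h1 := hφ.le_polynomial t
  nlinarith [mul_nonneg (sq_nonneg t) (sub_nonneg.2 ht)]

lemma integral_mul_exp_profile_le_of_sq_le (hφ : IsProfile a φ) (ha : a ≤ -1) {r : ℝ} (hr : 0 ≤ r)
    (hra : r ^ 2 ≤ -2 * a) : ∫ t in (0 : ℝ)..r, t * Real.exp (6 * φ t) ≤ 1 / 3 := by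
  have hc := hφ.1
  refine le_trans ?_ (integral_mul_exp_le ha r)
  apply intervalIntegral.integral_mono_on hr (Continuous.intervalIntegrable (by fun_prop) _ _)
    (Continuous.intervalIntegrable (by fun_prop) _ _)
  intro t ht
  have : t ^ 2 ≤ r ^ 2 := pow_le_pow_left₀ ht.1 ht.2 2
  exact mul_le_mul_of_nonneg_left (hφ.exp_le_of_sq_le (this.trans hra)) ht.1

/-- Where t² ≥ -2a, the weight t is at most t⁵/(4a²); this is the source of the factor a² in the
volume bound. -/
lemma integral_mul_exp_profile_le (hφ : IsProfile a φ) (ha : a ≤ -1) {r : ℝ} (hr : 0 ≤ r) :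
    ∫ t in (0 : ℝ)..r, t * Real.exp (6 * φ t) ≤
      1 / 3 + 1 / (4 * a ^ 2) * ∫ t in (0 : ℝ)..r, t ^ 5 * Real.exp (6 * φ t) := by
  have hc := hφ.1
  refine le_trans ?_ (add_le_add_left (integral_mul_exp_le ha r) _)
  rw [← intervalIntegral.integral_const_mul, ← intervalIntegral.integral_add
    (Continuous.intervalIntegrable (by fun_prop) _ _)
    (Continuous.intervalIntegrable (by fun_prop) _ _)]
  apply intervalIntegral.integral_mono_on hr (Continuous.intervalIntegrable (by fun_prop) _ _)
    (Continuous.intervalIntegrable (by fun_prop) _ _)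
  intro t ht
  have ht0 : 0 ≤ t := ht.1
  rcases le_total (t ^ 2) (-2 * a) with h1 | h1
  · have h2 := mul_le_mul_of_nonneg_left (hφ.exp_le_of_sq_le h1) ht0
    have h3 : 0 ≤ 1 / (4 * a ^ 2) * (t ^ 5 * Real.exp (6 * φ t)) := by positivity
    linarith
  · have h2 : 4 * a ^ 2 ≤ t ^ 4 := by nlinarith
    have ha2 : 0 < 4 * a ^ 2 := by nlinarith
    have h3 : t * Real.exp (6 * φ t) ≤ 1 / (4 * a ^ 2) * (t ^ 5 * Real.exp (6 * φ t)) := by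
      rw [div_mul_eq_mul_div, one_mul, le_div_iff₀ ha2]
      have : t * Real.exp (6 * φ t) * (4 * a ^ 2) ≤ t * Real.exp (6 * φ t) * t ^ 4 := by gcongr
      linarith
    have h4 : 0 ≤ t * Real.exp (3 / 2 * a * t ^ 2) := by positivity
    linarith

/-- For very negative `a` the bilaplacian of `u_{a,3}`, which is `48` at the origin, becomes
negative. -/
lemma exists_bilaplacian_neg (hφ : IsProfile a φ) (ha : a ≤ -1) :
    ∃ r, 0 ≤ r ∧ 48 < radialPotential (fun t => Real.exp (6 * φ t)) r := by
  obtain ⟨hφc, hφe⟩ := id hφ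
  set E : ℝ → ℝ := fun r => Real.exp (6 * φ r) with hE
  have hEc : Continuous E := by fun_prop
  have hTE := continuous_radialPotential hEc
  set w : ℝ → ℝ := fun r => 48 - radialPotential E r with hw
  have hwc : Continuous w := by fun_prop
  have hTw := continuous_radialPotential hwc
  set v : ℝ → ℝ := fun r => 6 * a + radialPotential w r with hv
  have hvc : Continuous v := by fun_prop
  have hφv : radialPotential v = φ := hφe
  by_contra! hcon
  have hw0 : ∀ r, 0 ≤ r → 0 ≤ w r := fun r hr => sub_nonneg.2 (hcon r hr)
  set r₀ : ℝ := √(-2 * a) with hr₀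
  have hr₀0 : 0 ≤ r₀ := Real.sqrt_nonneg _
  have hr₀2 : r₀ ^ 2 = -2 * a := Real.sq_sqrt (by linarith)
  have hv0 : 1 ≤ v r₀ := by
    -- Up to r₀ the potential of E is at most 1/12, so w ≥ 47. Then v(r₀) ≥ 6a - 47a/6 = -11a/6 ≥ 1.
    have h1 : radialPotential (fun _ => 47) r₀ ≤ radialPotential w r₀ := by
      refine radialPotential_mono continuous_const hwc fun t ht htr => ?_
      rw [abs_of_nonneg hr₀0] at htr
      have h2 := radialPotential_le_integral hEc (fun t _ => (Real.exp_pos _).le) ht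
      have h3 := hφ.integral_mul_exp_profile_le_of_sq_le ha ht
        ((pow_le_pow_left₀ ht htr 2).trans hr₀2.le)
      simp only [hw]
      linarith
    rw [radialPotential_const, hr₀2] at h1
    simp only [hv]
    linarith
  have hv1 : ∀ t, r₀ ≤ t → 1 ≤ v t := by
    intro t ht
    have h1 : MonotoneOn (radialPotential w) (Set.Ici 0) := by
      refine radialPotential_monotoneOn hwc le_rfl fun s hs => ?_
      have := ballMean_mono (continuous_const (y := (0 : ℝ))) hwc hs.le fun t ht _ => hw0 t ht
      simpa [ballMean] using this
    have h2 := h1 (Set.mem_Ici.2 hr₀0) (Set.mem_Ici.2 (hr₀0.trans ht)) ht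
    simp only [hv] at hv0 ⊢
    linarith
  obtain ⟨B, hB⟩ := exists_radialPotential_ge hvc one_pos hv1
  have hE1 : ∀ t, 24 * |B| + 1 ≤ t → 1 ≤ E t := by
    intro t ht
    have ht1 : 1 ≤ t := by linarith [abs_nonneg B]
    have h1 := hB t (by linarith)
    rw [hφv] at h1
    apply Real.one_le_exp
    nlinarith [le_abs_self B]
  obtain ⟨B', hB'⟩ := exists_radialPotential_ge hEc one_pos hE1
  -- As R ≥ 1, R²/24 - B' ≥ R/24 - |B'| = 49, which exceeds 48.
  set R : ℝ := 24 * |B'| + 24 * 49 with hR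
  have hR1 : 1 ≤ R := by linarith [abs_nonneg B']
  have h1 := hB' R (by linarith)
  have h2 := hcon R (by linarith)
  nlinarith [le_abs_self B']

/-- Once negative, w stays below a negative constant because T(e^{6φ}) is nondecreasing. Quadratic
growth applied to -w and then to -v gives φ ≤ B' - r²/24, and 6/24 is the Gaussian rate 1/4. -/
lemma exists_exp_le_gaussian (hφ : IsProfile a φ) (ha : a ≤ -1) :
    ∃ C, ∀ r, 0 ≤ r → Real.exp (6 * φ r) ≤ C * Real.exp (-(1 / 4) * r ^ 2) := by
  obtain ⟨r₁, hr₁, hlt⟩ := hφ.exists_bilaplacian_neg ha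
  obtain ⟨hφc, hφe⟩ := id hφ
  set E : ℝ → ℝ := fun r => Real.exp (6 * φ r) with hE
  have hEc : Continuous E := by fun_prop
  have hTE := continuous_radialPotential hEc
  set w : ℝ → ℝ := fun r => 48 - radialPotential E r with hw
  have hwc : Continuous w := by fun_prop
  have hTw := continuous_radialPotential hwc
  set v : ℝ → ℝ := fun r => 6 * a + radialPotential w r with hv
  have hvc : Continuous v := by fun_prop
  have hφv : radialPotential v = φ := hφe
  have hmono : MonotoneOn (radialPotential E) (Set.Ici 0) := by
    refine radialPotential_monotoneOn hEc le_rfl fun s hs => ?_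
    have := ballMean_mono (continuous_const (y := (0 : ℝ))) hEc hs.le
      fun t _ _ => (Real.exp_pos _).le
    simpa [ballMean] using this
  have hwneg : ∀ t, r₁ ≤ t → -w r₁ ≤ -w t := by
    intro t ht
    have := hmono (Set.mem_Ici.2 hr₁) (Set.mem_Ici.2 (hr₁.trans ht)) ht
    simp only [hw]
    linarith
  have hw₁ : 0 < -w r₁ := by
    simp only [hw]
    linarith
  obtain ⟨B, hB⟩ := exists_radialPotential_ge hwc.neg hw₁ hwneg
  -- The threshold makes the potential of -w nonnegative; the bound 1 then comes from -6a ≥ 6.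
  have hvneg : ∀ t, (|B| / (-w r₁ / 24)) + 1 ≤ t → 1 ≤ -v t := by
    intro t ht
    have hk : 0 < -w r₁ / 24 := by positivity
    have hd : 0 ≤ |B| / (-w r₁ / 24) := by positivity
    have h1 := hB t (by linarith)
    have h2 : radialPotential (-w) t = -radialPotential w t := radialPotential_neg t
    rw [h2] at h1
    have h3 : |B| / (-w r₁ / 24) ≤ t ^ 2 := by nlinarith
    have h4 : |B| ≤ t ^ 2 * (-w r₁ / 24) := (div_le_iff₀ hk).1 h3
    simp only [hv]
    linarith [le_abs_self B]
  obtain ⟨B', hB'⟩ := exists_radialPotential_ge hvc.neg one_pos hvneg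
  refine ⟨Real.exp (6 * B'), fun r hr => ?_⟩
  have h1 := hB' r hr
  have h2 : radialPotential (-v) r = -radialPotential v r := radialPotential_neg r
  rw [h2, hφv] at h1
  rw [← Real.exp_add]
  apply Real.exp_le_exp.2
  linarith

lemma integrable_exp (hφ : IsProfile a φ) (ha : a ≤ -1) :
    Integrable fun x : R6 => Real.exp (6 * φ ‖x‖) := by
  obtain ⟨C, hC⟩ := hφ.exists_exp_le_gaussian ha
  have hc := hφ.1
  have h1 : Integrable fun x : R6 => Real.exp (-(1 / 4) * ‖x‖ ^ 2) := by
    -- A non-integrable function has integral 0 by convention, whereas the Gaussian formula gives a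
    -- positive value.
    by_contra hcon
    have h2 := integral_undef hcon
    rw [GaussianFourier.integral_rexp_neg_mul_sq_norm (by norm_num)] at h2
    have : (0 : ℝ) < (Real.pi / (1 / 4)) ^ (Module.finrank ℝ R6 / 2 : ℝ) := by positivity
    linarith
  refine (h1.const_mul C).mono' (Continuous.aestronglyMeasurable (by fun_prop)) ?_
  refine Eventually.of_forall fun x => ?_
  rw [Real.norm_of_nonneg (Real.exp_pos _).le]
  exact hC _ (norm_nonneg x)

lemma le_integral_exp (hφ : IsProfile a φ) (ha : a ≤ -1) :
    6 * volume.real (Metric.ball (0 : R6) 1) * a ^ 2 ≤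
      ∫ x : R6, Real.exp (6 * φ ‖x‖) := by
  obtain ⟨r, hr, hlt⟩ := hφ.exists_bilaplacian_neg ha
  have hc := hφ.1
  have hEc : Continuous fun t => Real.exp (6 * φ t) := by fun_prop
  have h1 := radialPotential_le_integral hEc (fun t _ => (Real.exp_pos _).le) hr
  have h2 := hφ.integral_mul_exp_profile_le ha hr
  set J := ∫ t in (0 : ℝ)..r, t ^ 5 * Real.exp (6 * φ t) with hJ
  have ha2 : 0 < a ^ 2 := by nlinarith
  have h3 : a ^ 2 ≤ J := by
    -- From 48 < ¼(1/3 + J/(4a²)); the lower bound 1 is far from sharp but suffices.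
    have h4 : 1 ≤ 1 / (4 * a ^ 2) * J := by linarith
    rw [div_mul_eq_mul_div, one_mul, one_le_div (by positivity)] at h4
    linarith
  have hint := (integrable_fun_norm_addHaar (volume : Measure R6)
    (f := fun t => Real.exp (6 * φ t))).1 (hφ.integrable_exp ha)
  have h5 := integral_fun_norm_addHaar (volume : Measure R6) fun t => Real.exp (6 * φ t)
  simp only [finrank_euclideanSpace, Fintype.card_fin, nsmul_eq_mul, smul_eq_mul] at h5 hint
  have h6 : J ≤ ∫ y in Set.Ioi (0 : ℝ), y ^ (6 - 1) * Real.exp (6 * φ y) := by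
    rw [hJ, intervalIntegral.integral_of_le hr]
    refine setIntegral_mono_set hint ?_ (Set.Ioc_subset_Ioi_self.eventuallyLE)
    filter_upwards [ae_restrict_mem measurableSet_Ioi] with y hy
    exact mul_nonneg (pow_nonneg (le_of_lt hy) _) (Real.exp_pos _).le
  rw [h5]
  push_cast
  rw [mul_assoc]
  gcongr
  exact h3.trans h6

end IsProfile

/-! ### Geometric reformulation and the main theorem -/

lemma IsRadialSolution.qCurvature_eq_one {a b : ℝ} {u : R6 → ℝ} (hu : IsRadialSolution a b u)
    (x : R6) : qCurvature u x = 1 := by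
  have h1 : (fun f : R6 → ℝ => -Δ f)^[3] u = -Δ (Δ (Δ u)) := by
    simp [InnerProductSpace.laplacian_neg]
  rw [qCurvature, h1, Pi.neg_apply, hu.equation, neg_neg, ← Real.exp_add]
  simp

lemma riemannianVolume_conformalMetric (u : R6 → ℝ) :
    riemannianVolume (conformalMetric u) = ∫⁻ x, ENNReal.ofReal (Real.exp (6 * u x)) := by
  unfold riemannianVolume conformalMetric
  congr 1
  ext x
  have h1 : Real.exp (2 * u x) ^ 6 = Real.exp (6 * u x) ^ 2 := by
    rw [← Real.exp_nat_mul, ← Real.exp_nat_mul]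
    congr 1
    push_cast
    ring
  rw [Matrix.det_smul, Matrix.det_one, mul_one, Fintype.card_fin, h1,
    Real.sqrt_sq (Real.exp_pos _).le]

/-- The family `u` is constrained only for a < 0, where the first clause determines it; limits at -∞
ignore its other values. -/
theorem theorem2 :
    (∀ a : ℝ, a < 0 → ∃! u : R6 → ℝ, IsRadialSolution a 3 u) ∧
    ∀ u : ℝ → R6 → ℝ, (∀ a : ℝ, a < 0 → IsRadialSolution a 3 (u a)) →
      ((∀ᶠ a : ℝ in atBot, Integrable (fun x : R6 => Real.exp (6 * u a x))) ∧
        Tendsto (fun a : ℝ => ∫ x : R6, Real.exp (6 * u a x)) atBot atTop) ∧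
      ((∀ a : ℝ, a < 0 → ∀ x : R6, qCurvature (u a) x = 1) ∧
        (∀ᶠ a : ℝ in atBot, riemannianVolume (conformalMetric (u a)) < ∞) ∧
        Tendsto (fun a : ℝ => riemannianVolume (conformalMetric (u a))) atBot (𝓝 ∞)) := by
  refine ⟨fun a ha => existsUnique_isRadialSolution ha, fun u hu => ?_⟩
  have hu_eq : ∀ a, a < 0 → ∀ x, u a x = radialProfile (u a) ‖x‖ := fun a ha x =>
    (hu a ha).radial.eq_radialProfile x
  have hint : ∀ a, a ≤ -1 → Integrable fun x : R6 => Real.exp (6 * u a x) := by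
    intro a ha
    simp only [hu_eq a (by linarith)]
    exact (hu a (by linarith)).isProfile.integrable_exp ha
  have hge : ∀ a, a ≤ -1 → 6 * volume.real (Metric.ball (0 : R6) 1) * a ^ 2 ≤
      ∫ x : R6, Real.exp (6 * u a x) := by
    intro a ha
    simp only [hu_eq a (by linarith)]
    exact (hu a (by linarith)).isProfile.le_integral_exp ha
  have hball : 0 < volume.real (Metric.ball (0 : R6) 1) :=
    ENNReal.toReal_pos (Metric.measure_ball_pos volume 0 one_pos).ne' measure_ball_lt_top.ne
  have hlim : Tendsto (fun a : ℝ => ∫ x : R6, Real.exp (6 * u a x)) atBot atTop := by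
    have h1 : Tendsto (fun a : ℝ => a ^ 2) atBot atTop := by
      simpa [sq] using tendsto_id.atBot_mul_atBot₀ (tendsto_id (α := ℝ) (x := atBot))
    refine tendsto_atTop_mono' _ ?_
      (h1.const_mul_atTop (by positivity : 0 < 6 * volume.real (Metric.ball (0 : R6) 1)))
    filter_upwards [eventually_le_atBot (-1 : ℝ)] with a ha
    exact hge a ha
  have hvol : ∀ a, a ≤ -1 → riemannianVolume (conformalMetric (u a)) =
      ENNReal.ofReal (∫ x : R6, Real.exp (6 * u a x)) := by
    intro a ha
    rw [riemannianVolume_conformalMetric, ofReal_integral_eq_lintegral_ofReal (hint a ha)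
      (Eventually.of_forall fun x => (Real.exp_pos _).le)]
  refine ⟨⟨?_, hlim⟩, fun a ha => (hu a ha).qCurvature_eq_one, ?_, ?_⟩
  · filter_upwards [eventually_le_atBot (-1 : ℝ)] with a ha
    exact hint a ha
  · filter_upwards [eventually_le_atBot (-1 : ℝ)] with a ha
    rw [hvol a ha]
    exact ENNReal.ofReal_lt_top
  · refine (ENNReal.tendsto_ofReal_atTop.comp hlim).congr' ?_
    filter_upwards [eventually_le_atBot (-1 : ℝ)] with a ha
    exact (hvol a ha).symm
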